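/- An integer linear system (ILS) $I=(A,b,d)$ consists of a matrix $A=(a_{ij})\in\mathbb{Q}^{m\times n}$, a vector $b\in\mathbb{Q}^m$ and a positive integer $d$, with $m,n\ge 1$. Its feasible solutions are the vectors $x\in\{0,1,\dots,d\}^n$ with $Ax\ge b$. Its solution graph $G(I)$ has the feasible solutions as vertices, two of them being adjacent iff they differ in exactly one coordinate. The complexity index $Z(I)$ is the optimal value of the linear program: minimize $Z$ subject to $\sum_{j:\,a_{ij}>0}\alpha_j+\sum_{j:\,a_{ij}<0}(1-\alpha_j)\le Z$ for $i=1,\dots,m$ and $0\le\alpha_j\le 1$ for $j=1,\dots,n$. Let $\mathrm{ILS}(1)$ be the family of all ILSes $I$ with $Z(I)\le 1$. Theorem. The reconfiguration problem of $\mathrm{ILS}(1)$ (given $I\in\mathrm{ILS}(1)$ and two feasible solutions $s,t$ of $I$, decide whether $t$ is reachable from $s$ in $G(I)$) is pseudo-polynomially solvable, i.e. in time polynomial in $n$, $m$ and $d$. Precisely: there is a single random access machine program (integer registers and arrays; addition, subtraction, multiplication, sign tests; rational entries given by numerator and denominator in lowest terms) that, on every such input $(I,s,t)$, halts with the correct answer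 after a number of elementary operations bounded by a polynomial in $n$, $m$ and $d$, and whose running time in the logarithmic (bit) cost model is bounded by a polynomial in $n$, $m$, $d$ and the total number of bits of the entries of $A$ and $b$. -/

import Mathlib

/-- An integer linear system `I = (A, b, d)`: a matrix `A ∈ ℚ^{m × n}`, a vector `b ∈ ℚ^m` and
a positive integer `d`, where `m` and `n` are positive integers. -/
structure ILS where
  m : ℕ
  n : ℕ
  d : ℕ
  m_pos : 0 < m
  n_pos : 0 < n
  d_pos : 0 < d
  A : Matrix (Fin m) (Fin n) ℚ
  b : Fin m → ℚ

/-- The solution graph `G(R)` of a relation `R ⊆ D^n` on `D = {0, 1, …, d}`: its vertices are the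
elements of `R`, two of them being adjacent iff their Hamming distance is one. -/
def solutionGraph {n d : ℕ} (R : Set (Fin n → Fin (d + 1))) : SimpleGraph R where
  Adj x y := hammingDist x.1 y.1 = 1
  symm := ⟨fun x y h => by rw [hammingDist_comm]; exact h⟩
  loopless := ⟨fun x h => by simp at h⟩

namespace ILS

/-- The set `R(I)` of feasible solutions: the vectors `x ∈ {0, …, d}^n` with `A x ≥ b`. -/
def solutions (I : ILS) : Set (Fin I.n → Fin (I.d + 1)) :=
  {x | I.b ≤ I.A.mulVec (fun j => ((x j : ℕ) : ℚ))}

/-- The solution graph `G(I)`. -/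
def graph (I : ILS) : SimpleGraph I.solutions :=
  solutionGraph I.solutions

/-- `(Z, α)` is feasible for the linear program that defines the complexity index. -/
def IsLPFeasible (I : ILS) (Z : ℝ) (α : Fin I.n → ℝ) : Prop :=
  (∀ i : Fin I.m,
    ∑ j with 0 < I.A i j, α j + ∑ j with I.A i j < 0, (1 - α j) ≤ Z) ∧
  ∀ j : Fin I.n, 0 ≤ α j ∧ α j ≤ 1

/-- The complexity index `Z(I)`: the optimal (minimum) value of the linear program. -/
noncomputable def complexityIndex (I : ILS) : ℝ :=
  sInf {Z : ℝ | ∃ α : Fin I.n → ℝ, I.IsLPFeasible Z α}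

/-- `ILS(γ)`: the family of the integer linear systems with complexity index at most `γ`. -/
def family (γ : ℝ) : Set ILS :=
  {I | I.complexityIndex ≤ γ}

/-- Number of bits of an integer in binary (with a sign bit). -/
def intBits (z : ℤ) : ℕ := 1 + z.natAbs.size

/-- Number of bits of a rational, written as numerator and denominator in lowest terms. -/
def ratBits (x : ℚ) : ℕ := intBits x.num + intBits (x.den : ℤ)

/-- Total number of bits of the entries of `A` and `b`. -/
def bitLength (I : ILS) : ℕ :=
  ∑ i, ∑ j, ratBits (I.A i j) + ∑ i, ratBits (I.b i)

end ILS

/-! Random access machines, as structured programs. A machine has integer registers `0, 1, 2, …` and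
arrays `0, 1, 2, …` of integers with random access (a program names finitely many of them).
Available arithmetic: addition, subtraction, multiplication, and the test `0 < e`. -/

namespace RAM

/-- Expressions: integer constants, registers, array cells `a[i]` with a computed index,
and arithmetic. -/
inductive Expr : Type
  | const (c : ℤ)
  | reg (x : ℕ)
  | cell (a : ℕ) (i : Expr)
  | add (e f : Expr)
  | sub (e f : Expr)
  | mul (e f : Expr)

/-- Programs. -/
inductive Prog : Type
  | skip
  /-- `register x := e` -/
  | assign (x : ℕ) (e : Expr)
  /-- `array a at index i := e` -/
  | store (a : ℕ) (i e : Expr)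
  | seq (P Q : Prog)
  /-- `if 0 < e then P else Q` -/
  | ite (e : Expr) (P Q : Prog)
  /-- `while 0 < e do P` -/
  | loop (e : Expr) (P : Prog)

/-- The contents of the registers and of the arrays. -/
structure State where
  reg : ℕ → ℤ
  arr : ℕ → ℤ → ℤ

/-- Value of an expression. -/
def Expr.eval (σ : State) : Expr → ℤ
  | .const c => c
  | .reg x => σ.reg x
  | .cell a i => σ.arr a (i.eval σ)
  | .add e f => e.eval σ + f.eval σ
  | .sub e f => e.eval σ - f.eval σ
  | .mul e f => e.eval σ * f.eval σ

/-- Cost of evaluating an expression, when producing a value `z` (by an access or by an arithmetic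
operation) costs `w z`. All intermediate values, the indices of array cells included, are charged. -/
def Expr.cost (w : ℤ → ℕ) (σ : State) : Expr → ℕ
  | .const c => w c
  | .reg x => w (σ.reg x)
  | .cell a i => i.cost w σ + w (σ.arr a (i.eval σ))
  | .add e f => e.cost w σ + f.cost w σ + w (e.eval σ + f.eval σ)
  | .sub e f => e.cost w σ + f.cost w σ + w (e.eval σ - f.eval σ)
  | .mul e f => e.cost w σ + f.cost w σ + w (e.eval σ * f.eval σ)

/-- Replace the content of register `x` by `z`. -/
def State.setReg (σ : State) (x : ℕ) (z : ℤ) : State :=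
  { σ with reg := Function.update σ.reg x z }

/-- Replace the content of cell `i` of array `a` by `z`. -/
def State.setCell (σ : State) (a : ℕ) (i z : ℤ) : State :=
  { σ with arr := Function.update σ.arr a (Function.update (σ.arr a) i z) }

/-- `Exec w P σ T τ`: the program `P`, started in the state `σ`, halts in the state `τ` after the
time `T`. Every execution of a command and every evaluation of a test costs `1` plus the cost of the
expressions that are evaluated for it. -/
inductive Exec (w : ℤ → ℕ) : Prog → State → ℕ → State → Prop
  | skip (σ : State) : Exec w .skip σ 1 σ
  | assign (σ : State) (x : ℕ) (e : Expr) :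
      Exec w (.assign x e) σ (1 + e.cost w σ) (σ.setReg x (e.eval σ))
  | store (σ : State) (a : ℕ) (i e : Expr) :
      Exec w (.store a i e) σ (1 + i.cost w σ + e.cost w σ) (σ.setCell a (i.eval σ) (e.eval σ))
  | seq {P Q : Prog} {σ τ ρ : State} {S T : ℕ} (hP : Exec w P σ S τ) (hQ : Exec w Q τ T ρ) :
      Exec w (.seq P Q) σ (S + T) ρ
  | ite_pos {e : Expr} {P Q : Prog} {σ τ : State} {T : ℕ} (he : 0 < e.eval σ)
      (hP : Exec w P σ T τ) : Exec w (.ite e P Q) σ (1 + e.cost w σ + T) τ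
  | ite_neg {e : Expr} {P Q : Prog} {σ τ : State} {T : ℕ} (he : ¬ 0 < e.eval σ)
      (hQ : Exec w Q σ T τ) : Exec w (.ite e P Q) σ (1 + e.cost w σ + T) τ
  | loop_pos {e : Expr} {P : Prog} {σ τ ρ : State} {S T : ℕ} (he : 0 < e.eval σ)
      (hP : Exec w P σ S τ) (hL : Exec w (.loop e P) τ T ρ) :
      Exec w (.loop e P) σ (1 + e.cost w σ + S + T) ρ
  | loop_neg {e : Expr} {P : Prog} {σ : State} (he : ¬ 0 < e.eval σ) :
      Exec w (.loop e P) σ (1 + e.cost w σ) σ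

/-- Uniform cost: every elementary operation takes one step. -/
def uniformCost : ℤ → ℕ := fun _ => 1

/-- Logarithmic cost: every elementary operation costs the number of bits of the value produced. -/
def logCost : ℤ → ℕ := ILS.intBits

/-- The array that starts with the entries of `f` and is zero elsewhere. -/
def tabulate {k : ℕ} (f : Fin k → ℤ) (i : ℤ) : ℤ :=
  if h : 0 ≤ i ∧ i < k then f ⟨i.toNat, by omega⟩ else 0

/-- The input of the reconfiguration problem. Registers `0, 1, 2` hold `n, m, d`. Arrays `0, 1` hold
the numerators and the denominators of `A` row by row (the entry `A i j` at index `i * n + j`),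
arrays `2, 3` those of `b`, and arrays `4, 5` hold `s` and `t`. All the rest is zero. -/
def input (I : ILS) (s t : I.solutions) : State where
  reg x := if x = 0 then I.n else if x = 1 then I.m else if x = 2 then I.d else 0
  arr a :=
    if a = 0 then tabulate fun k => (I.A (finProdFinEquiv.symm k).1 (finProdFinEquiv.symm k).2).num
    else if a = 1 then
      tabulate fun k => ((I.A (finProdFinEquiv.symm k).1 (finProdFinEquiv.symm k).2).den : ℤ)
    else if a = 2 then tabulate fun i => (I.b i).num
    else if a = 3 then tabulate fun i => ((I.b i).den : ℤ)
    else if a = 4 then tabulate fun j => ((s.1 j : ℕ) : ℤ)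
    else if a = 5 then tabulate fun j => ((t.1 j : ℕ) : ℤ)
    else 0

/-- The program `P` answers a yes/no question with the truth value `p`, from the initial state `σ`
and with the operation costs `w`, within the time `T`. The answer is left in register `0`:
`1` for yes and `0` for no. -/
def Answers (w : ℤ → ℕ) (P : Prog) (σ : State) (p : Prop) (T : ℕ) : Prop :=
  ∃ (T' : ℕ) (τ : State), Exec w P σ T' τ ∧ T' ≤ T ∧
    (p → τ.reg 0 = 1) ∧ (¬ p → τ.reg 0 = 0)

end RAM

/-! A literal is a coordinate with a direction. Draw an edge `l → l'` when some row is lowered by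
moving along `l` and raised by moving a different coordinate along `l'`; this graph is invariant
under contraposition. Let `C` be closed under edges, and push a solution in the directions that `C`
gives unambiguously until no feasible single move helps. The result bounds its whole component in
these directions: the first step of a path that overtook it could be made at the local maximum
itself, because every row lowered by that step has, at its other coordinates, terms at which the
local maximum is already at least as good (`update_mem_of_edgeClosed`). Hence two such local maxima
in one component agree wherever `C` has a direction (`eq_of_isLocMax`).

For every literal, `s` and `t` are pushed along its closure, giving `x` and `y`. Once a good literal
(one that does not imply its negation) is processed, `x` and `y` agree at its coordinate if `s` and
`t` are connected, and later pushes do not destroy this (`Pushed.step`). At the remaining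
coordinates both literals imply each other, so their weights in the linear program are close to 1/2,
and `Z ≤ 1` leaves room for at most two of them in a row (`rowsBijunctive`). The median of three
values is, in either direction, at least as good as two of them; so in a row with two such
coordinates the median is at least as good as one of the three points at both. Now move `x` towards
`y` while possible. If `x ≠ y` were still connected, the first solution on a path that moves from
`x` to the side of `y` would give, by a median with `x` and `y`, one more feasible move towards `y`
(`median_mem`, `eq_of_isLocMax_neg_sq`). Thus `s` and `t` are connected iff `x` ends at `y`
(`Pushed.conn_iff`).

An ascent has at most `n * d` moves and a closure at most `2 * n` new marks, so the number of
commands is polynomial in `n`, `m`, `d`. Memory stays below a bound `V` with polynomially many bits,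
and expressions of size at most 40 stay below `V ^ 40`. One program logic, parametrized by the price
`K` of an operation, therefore serves both cost models. -/

namespace RAM

/-! ### Cost accounting and a program logic for total correctness -/

/-- Number of nodes of an expression. -/
def Expr.size : Expr → ℕ
  | .const _ => 1
  | .reg _ => 1
  | .cell _ i => i.size + 1
  | .add e f => e.size + f.size + 1
  | .sub e f => e.size + f.size + 1
  | .mul e f => e.size + f.size + 1

/-- All constants of the expression have absolute value at most two. -/
def Expr.SmallConst : Expr → Bool
  | .const c => c.natAbs ≤ 2
  | .reg _ => true
  | .cell _ i => i.SmallConst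
  | .add e f => e.SmallConst && f.SmallConst
  | .sub e f => e.SmallConst && f.SmallConst
  | .mul e f => e.SmallConst && f.SmallConst

/-- Expressions of bounded size with small constants. -/
def Expr.Simple (e : Expr) : Bool := e.size ≤ 40 && e.SmallConst

/-- All registers and all array cells have absolute value at most `V`. -/
def State.Bdd (V : ℕ) (σ : State) : Prop :=
  (∀ x, (σ.reg x).natAbs ≤ V) ∧ ∀ a i, (σ.arr a i).natAbs ≤ V

theorem Expr.size_pos (e : Expr) : 0 < e.size := by
  cases e <;> simp [Expr.size]

theorem pow_add_pow_le_pow {V a b : ℕ} (hV : 2 ≤ V) (ha : 0 < a) (hb : 0 < b) :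
    V ^ a + V ^ b ≤ V ^ (a + b + 1) := by
  have h1 : V ^ a ≤ V ^ (a + b) := Nat.pow_le_pow_right (by omega) (by omega)
  have h2 : V ^ b ≤ V ^ (a + b) := Nat.pow_le_pow_right (by omega) (by omega)
  calc V ^ a + V ^ b ≤ V ^ (a + b) * 2 := by omega
    _ ≤ V ^ (a + b) * V := Nat.mul_le_mul_left _ hV
    _ = V ^ (a + b + 1) := (pow_succ _ _).symm

/-- Products add exponents; for sums the extra node pays for the factor two, as `2 ≤ V`. -/
theorem Expr.natAbs_eval_le {V : ℕ} (hV : 2 ≤ V) {σ : State} (hσ : σ.Bdd V) :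
    ∀ e : Expr, e.SmallConst = true → (e.eval σ).natAbs ≤ V ^ e.size
  | .const c, h => by
    simp only [SmallConst, decide_eq_true_eq] at h
    simp only [eval, size, pow_one]
    omega
  | .reg x, _ => by simpa [eval, size] using hσ.1 x
  | .cell a i, _ => by
    refine (hσ.2 a _).trans ?_
    exact Nat.le_self_pow (by simp [size]) V
  | .add e f, h => by
    simp only [SmallConst, Bool.and_eq_true] at h
    exact (Int.natAbs_add_le _ _).trans <| (Nat.add_le_add (natAbs_eval_le hV hσ e h.1)
      (natAbs_eval_le hV hσ f h.2)).trans (pow_add_pow_le_pow hV e.size_pos f.size_pos)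
  | .sub e f, h => by
    simp only [SmallConst, Bool.and_eq_true] at h
    exact (Int.natAbs_sub_le _ _).trans <| (Nat.add_le_add (natAbs_eval_le hV hσ e h.1)
      (natAbs_eval_le hV hσ f h.2)).trans (pow_add_pow_le_pow hV e.size_pos f.size_pos)
  | .mul e f, h => by
    simp only [SmallConst, Bool.and_eq_true] at h
    simp only [eval, size, Int.natAbs_mul]
    refine (Nat.mul_le_mul (natAbs_eval_le hV hσ e h.1) (natAbs_eval_le hV hσ f h.2)).trans ?_
    rw [← pow_add]
    exact Nat.pow_le_pow_right (by omega) (by omega)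

/-- Costs `w` that are at most `K` on the values that arise when the memory is bounded by `V`;
`N` bounds the number of iterations of the loops. -/
structure CostBound where
  w : ℤ → ℕ
  V : ℕ
  N : ℕ
  K : ℕ
  two_le : 2 ≤ V
  w_le : ∀ z : ℤ, z.natAbs ≤ V ^ 40 → w z ≤ K

namespace CostBound

variable (B : CostBound)

theorem expr_cost_le_size {σ : State} (hσ : σ.Bdd B.V) :
    ∀ e : Expr, e.size ≤ 40 → e.SmallConst = true → e.cost B.w σ ≤ e.size * B.K := by
  have key : ∀ e : Expr, e.size ≤ 40 → e.SmallConst = true → B.w (e.eval σ) ≤ B.K :=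
    fun e h1 h2 => B.w_le _ <| (e.natAbs_eval_le B.two_le hσ h2).trans
      (Nat.pow_le_pow_right (by have := B.two_le; omega) h1)
  intro e
  induction e with
  | const c => intro h1 h2; simpa [Expr.size, Expr.cost, Expr.eval] using key (.const c) h1 h2
  | reg x => intro h1 h2; simpa [Expr.size, Expr.cost, Expr.eval] using key (.reg x) h1 h2
  | cell a i ih =>
    intro h1 h2
    have h3 := key (.cell a i) h1 h2
    simp only [Expr.size, Expr.cost, Expr.eval, Expr.SmallConst] at *
    have := ih (by omega) h2
    nlinarith
  | add e f ihe ihf | sub e f ihe ihf | mul e f ihe ihf =>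
    intro h1 h2
    have h3 := key _ h1 h2
    simp only [Expr.size, Expr.cost, Expr.eval, Expr.SmallConst, Bool.and_eq_true] at *
    have := ihe (by omega) h2.1
    have := ihf (by omega) h2.2
    nlinarith

theorem expr_cost_le {σ : State} (hσ : σ.Bdd B.V) {e : Expr} (he : e.Simple = true) :
    e.cost B.w σ ≤ 40 * B.K := by
  simp only [Expr.Simple, Bool.and_eq_true, decide_eq_true_eq] at he
  exact (B.expr_cost_le_size hσ e he.1 he.2).trans (Nat.mul_le_mul_right _ he.1)

end CostBound

/-- Number of commands and tests that are executed, if every loop makes at most `N` iterations. -/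
def Prog.steps (N : ℕ) : Prog → ℕ
  | .skip => 1
  | .assign _ _ => 1
  | .store _ _ _ => 1
  | .seq P Q => P.steps N + Q.steps N
  | .ite _ P Q => 1 + P.steps N + Q.steps N
  | .loop _ P => 1 + N * (1 + P.steps N)

theorem Prog.exists_polynomial_steps (P : Prog) :
    ∃ p : Polynomial ℕ, ∀ N, P.steps N = p.eval N := by
  induction P with
  | skip | assign | store => exact ⟨1, fun N => by simp [steps]⟩
  | seq P Q hP hQ =>
    obtain ⟨p, hp⟩ := hP
    obtain ⟨q, hq⟩ := hQ
    exact ⟨p + q, fun N => by simp [steps, hp, hq]⟩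
  | ite e P Q hP hQ =>
    obtain ⟨p, hp⟩ := hP
    obtain ⟨q, hq⟩ := hQ
    exact ⟨1 + p + q, fun N => by simp [steps, hp, hq]⟩
  | loop e P hP =>
    obtain ⟨p, hp⟩ := hP
    exact ⟨1 + Polynomial.X * (1 + p), fun N => by simp [steps, hp]⟩

/-- The register `x` is written by the program. -/
def Prog.writesReg : Prog → ℕ → Bool
  | .skip, _ => false
  | .assign x _, y => y == x
  | .store _ _ _, _ => false
  | .seq P Q, y => P.writesReg y || Q.writesReg y
  | .ite _ P Q, y => P.writesReg y || Q.writesReg y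
  | .loop _ P, y => P.writesReg y

/-- The array `a` is written by the program. -/
def Prog.writesArr : Prog → ℕ → Bool
  | .skip, _ => false
  | .assign _ _, _ => false
  | .store a _ _, b => b == a
  | .seq P Q, y => P.writesArr y || Q.writesArr y
  | .ite _ P Q, y => P.writesArr y || Q.writesArr y
  | .loop _ P, y => P.writesArr y

/-- The two states differ at most in the registers and arrays that `P` writes. -/
structure Frame (P : Prog) (σ τ : State) : Prop where
  reg : ∀ x, P.writesReg x = false → τ.reg x = σ.reg x
  arr : ∀ a, P.writesArr a = false → τ.arr a = σ.arr a

theorem Frame.refl {P : Prog} {σ : State} : Frame P σ σ := ⟨fun _ _ => rfl, fun _ _ => rfl⟩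

theorem Frame.trans {P : Prog} {σ τ ρ : State} (h1 : Frame P σ τ) (h2 : Frame P τ ρ) :
    Frame P σ ρ :=
  ⟨fun x hx => (h2.reg x hx).trans (h1.reg x hx), fun a ha => (h2.arr a ha).trans (h1.arr a ha)⟩

theorem Frame.mono {P Q : Prog} {σ τ : State} (h : Frame P σ τ)
    (hr : ∀ x, Q.writesReg x = false → P.writesReg x = false)
    (ha : ∀ x, Q.writesArr x = false → P.writesArr x = false) : Frame Q σ τ :=
  ⟨fun x hx => h.reg x (hr x hx), fun a h' => h.arr a (ha a h')⟩

/-- What a program leaves untouched is read off its syntax, so for concrete programs the side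
conditions hold by `rfl`. -/
theorem Exec.frame {w : ℤ → ℕ} {P : Prog} {σ τ : State} {T : ℕ} (h : Exec w P σ T τ) :
    Frame P σ τ := by
  induction h with
  | skip | loop_neg => exact Frame.refl
  | assign σ x e =>
    refine ⟨fun y hy => ?_, fun _ _ => rfl⟩
    simp only [Prog.writesReg, beq_eq_false_iff_ne] at hy
    simp [State.setReg, hy]
  | store σ a i e =>
    refine ⟨fun _ _ => rfl, fun b hb => ?_⟩
    simp only [Prog.writesArr, beq_eq_false_iff_ne] at hb
    simp [State.setCell, hb]
  | seq _ _ h1 h2 =>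
    exact (h1.mono (by simp +contextual [Prog.writesReg]) (by simp +contextual [Prog.writesArr])).trans
      (h2.mono (by simp +contextual [Prog.writesReg]) (by simp +contextual [Prog.writesArr]))
  | ite_pos _ _ h1 | ite_neg _ _ h1 =>
    exact h1.mono (by simp +contextual [Prog.writesReg]) (by simp +contextual [Prog.writesArr])
  | loop_pos _ _ _ h1 h2 =>
    exact (h1.mono (by simp [Prog.writesReg]) (by simp [Prog.writesArr])).trans h2

namespace CostBound

variable (B : CostBound)

/-- From `σ`, the program halts within its time bound in a state which is bounded and has the
property `Q`. -/
def Wp (P : Prog) (σ : State) (Q : State → Prop) : Prop :=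
  ∃ T τ, Exec B.w P σ T τ ∧ T ≤ P.steps B.N * (1 + 80 * B.K) ∧ τ.Bdd B.V ∧ Q τ

variable {B}

theorem Wp.mono {P : Prog} {σ : State} {Q Q' : State → Prop} (h : B.Wp P σ Q)
    (hQ : ∀ τ, τ.Bdd B.V → Frame P σ τ → Q τ → Q' τ) : B.Wp P σ Q' := by
  obtain ⟨T, τ, h1, h2, h3, h4⟩ := h
  exact ⟨T, τ, h1, h2, h3, hQ τ h3 h1.frame h4⟩

theorem wp_skip {σ : State} {Q : State → Prop} (hσ : σ.Bdd B.V) (hQ : Q σ) : B.Wp .skip σ Q :=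
  ⟨1, σ, .skip σ, by simp only [Prog.steps]; omega, hσ, hQ⟩

theorem wp_assign {σ : State} {Q : State → Prop} {x : ℕ} {e : Expr} (hσ : σ.Bdd B.V)
    (he : e.Simple = true) (hV : (e.eval σ).natAbs ≤ B.V)
    (hQ : (σ.setReg x (e.eval σ)).Bdd B.V → Q (σ.setReg x (e.eval σ))) :
    B.Wp (.assign x e) σ Q := by
  have hb : (σ.setReg x (e.eval σ)).Bdd B.V := by
    refine ⟨fun y => ?_, hσ.2⟩
    by_cases h : y = x
    · subst h; simpa [State.setReg] using hV
    · simpa [State.setReg, h] using hσ.1 y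
  refine ⟨_, _, .assign σ x e, ?_, hb, hQ hb⟩
  have := B.expr_cost_le hσ he
  simp only [Prog.steps]
  omega

theorem wp_store {σ : State} {Q : State → Prop} {a : ℕ} {i e : Expr} (hσ : σ.Bdd B.V)
    (hi : i.Simple = true) (he : e.Simple = true) (hV : (e.eval σ).natAbs ≤ B.V)
    (hQ : (σ.setCell a (i.eval σ) (e.eval σ)).Bdd B.V → Q (σ.setCell a (i.eval σ) (e.eval σ))) :
    B.Wp (.store a i e) σ Q := by
  have hb : (σ.setCell a (i.eval σ) (e.eval σ)).Bdd B.V := by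
    refine ⟨hσ.1, fun b k => ?_⟩
    by_cases h : b = a
    · subst h
      by_cases hk : k = i.eval σ
      · subst hk; simpa [State.setCell] using hV
      · simpa [State.setCell, hk] using hσ.2 b k
    · simpa [State.setCell, h] using hσ.2 b k
  refine ⟨_, _, .store σ a i e, ?_, hb, hQ hb⟩
  have := B.expr_cost_le hσ he
  have := B.expr_cost_le hσ hi
  simp only [Prog.steps]
  omega

theorem wp_seq {P P' : Prog} {σ : State} {Q : State → Prop}
    (h : B.Wp P σ fun τ => B.Wp P' τ Q) : B.Wp (.seq P P') σ Q := by
  obtain ⟨T, τ, h1, h2, -, T', ρ, h1', h2', h3', h4'⟩ := h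
  exact ⟨_, ρ, .seq h1 h1', by simp only [Prog.steps, add_mul]; omega, h3', h4'⟩

theorem wp_ite {P P' : Prog} {σ : State} {Q : State → Prop} {e : Expr} (hσ : σ.Bdd B.V)
    (he : e.Simple = true) (h1 : 0 < e.eval σ → B.Wp P σ Q) (h2 : ¬ 0 < e.eval σ → B.Wp P' σ Q) :
    B.Wp (.ite e P P') σ Q := by
  have hc := B.expr_cost_le hσ he
  by_cases h : 0 < e.eval σ
  · obtain ⟨T, τ, g1, g2, g3, g4⟩ := h1 h
    refine ⟨_, τ, .ite_pos h g1, ?_, g3, g4⟩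
    simp only [Prog.steps, add_mul]
    nlinarith [Nat.zero_le (P'.steps B.N * (1 + 80 * B.K))]
  · obtain ⟨T, τ, g1, g2, g3, g4⟩ := h2 h
    refine ⟨_, τ, .ite_neg h g1, ?_, g3, g4⟩
    simp only [Prog.steps, add_mul]
    nlinarith [Nat.zero_le (P.steps B.N * (1 + 80 * B.K))]

end CostBound

/-- `for r = 0, …, e - 1 do P` -/
def forLoop (r : ℕ) (e : Expr) (P : Prog) : Prog :=
  .seq (.assign r (.const 0))
    (.loop (.sub e (.reg r)) (.seq P (.assign r (.add (.reg r) (.const 1)))))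

namespace CostBound

variable {B : CostBound}

/-- The invariant is stated after the counter has been set. The frame from the initial state is
available in every iteration, so `J` need only mention memory that the loop changes. -/
theorem wp_forLoop {r : ℕ} {e : Expr} {P : Prog} {σ : State} (k : ℕ) (J : ℕ → State → Prop)
    (hσ : σ.Bdd B.V) (he : (Expr.sub e (.reg r)).Simple = true) (hr : P.writesReg r = false)
    (hkN : k ≤ B.N) (hkV : k ≤ B.V) (h0 : J 0 (σ.setReg r 0))
    (hek : ∀ τ, Frame (forLoop r e P) σ τ → e.eval τ = k)
    (hstep : ∀ i < k, ∀ τ, τ.Bdd B.V → Frame (forLoop r e P) σ τ → τ.reg r = i → J i τ →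
      B.Wp P τ fun ρ => J (i + 1) (ρ.setReg r (i + 1))) :
    B.Wp (forLoop r e P) σ (J k) := by
  have hfr : ∀ {τ ρ : State} {Q : Prog}, Frame Q τ ρ →
      (∀ x, (forLoop r e P).writesReg x = false → Q.writesReg x = false) →
      (∀ x, (forLoop r e P).writesArr x = false → Q.writesArr x = false) →
      Frame (forLoop r e P) τ ρ := fun h h1 h2 => h.mono h1 h2
  -- `c` is the number of iterations left. Each consists of a test, the body and the increment; the
  -- bound is split because a test evaluates one expression, whereas a command is allowed `80 * B.K`
  -- for two.
  have main : ∀ c i, i + c = k → ∀ τ, τ.Bdd B.V → Frame (forLoop r e P) σ τ → τ.reg r = i →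
      J i τ → ∃ T ρ, Exec B.w (.loop (.sub e (.reg r))
        (.seq P (.assign r (.add (.reg r) (.const 1))))) τ T ρ ∧
        T ≤ (c * (2 + P.steps B.N) + 1) * (1 + 40 * B.K) + c * (P.steps B.N * (40 * B.K) +
          40 * B.K) ∧ ρ.Bdd B.V ∧ J k ρ := by
    intro c
    induction c with
    | zero =>
      intro i hi τ hτ hF hreg hJ
      have h : ¬ 0 < (Expr.sub e (.reg r)).eval τ := by
        simp only [Expr.eval, hek τ hF, hreg]; omega
      refine ⟨_, τ, .loop_neg h, ?_, hτ, ?_⟩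
      · have := B.expr_cost_le hτ he
        omega
      · obtain rfl : i = k := by omega
        exact hJ
    | succ c ih =>
      intro i hi τ hτ hF hreg hJ
      have h : 0 < (Expr.sub e (.reg r)).eval τ := by
        simp only [Expr.eval, hek τ hF, hreg]; omega
      have hc1 := B.expr_cost_le hτ he
      obtain ⟨T, ρ, g1, g2, g3, g4⟩ := hstep i (by omega) τ hτ hF hreg hJ
      have hreg' : ρ.reg r = i := (g1.frame.reg r hr).trans hreg
      have hA := wp_assign (B := B) (x := r) (e := .add (.reg r) (.const 1))
        (Q := fun ρ' => ρ' = ρ.setReg r (i + 1)) g3 (by rfl)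
        (by simp only [Expr.eval, hreg']; omega) (fun _ => by simp only [Expr.eval, hreg'])
      obtain ⟨T', ρ', k1, k2, k3, rfl⟩ := hA
      have hF' : Frame (forLoop r e P) σ (ρ.setReg r (i + 1)) :=
        hF.trans ((hfr g1.frame (by simp +contextual [forLoop, Prog.writesReg])
          (by simp +contextual [forLoop, Prog.writesArr])).trans
          (hfr k1.frame (by simp +contextual [forLoop, Prog.writesReg])
          (by simp +contextual [forLoop, Prog.writesArr])))
      obtain ⟨T'', ρ'', l1, l2, l3, l4⟩ := ih (i + 1) (by omega) _ k3 hF'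
        (by simp [State.setReg]) g4
      refine ⟨_, ρ'', .loop_pos h (.seq g1 k1) l1, ?_, l3, l4⟩
      simp only [Prog.steps] at k2
      nlinarith
  have h1 : (σ.setReg r 0).Bdd B.V ∧ Frame (forLoop r e P) σ (σ.setReg r 0) := by
    have hA := wp_assign (B := B) (x := r) (e := .const 0)
        (Q := fun ρ' => ρ' = σ.setReg r 0) hσ (by rfl) (by simp [Expr.eval])
        (fun _ => by simp only [Expr.eval])
    obtain ⟨T', ρ', k1, k2, k3, rfl⟩ := hA
    exact ⟨k3, hfr k1.frame (by simp +contextual [forLoop, Prog.writesReg])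
          (by simp +contextual [forLoop, Prog.writesArr])⟩
  obtain ⟨T, ρ, g1, g2, g3, g4⟩ := main k 0 (by omega) _ h1.1 h1.2 (by simp [State.setReg]) h0
  refine ⟨_, ρ, .seq (.assign σ r (.const 0)) g1, ?_, g3, g4⟩
  have hc := B.expr_cost_le hσ (e := .const 0) (by rfl)
  simp only [forLoop, Prog.steps]
  have hP : k * (2 + P.steps B.N) ≤ B.N * (2 + P.steps B.N) := Nat.mul_le_mul_right _ hkN
  have : k * (P.steps B.N * (40 * B.K) + 40 * B.K) ≤ B.N * (P.steps B.N * (40 * B.K) + 40 * B.K) :=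
    Nat.mul_le_mul_right _ hkN
  nlinarith [Nat.mul_le_mul_right (1 + 40 * B.K) hP]

end CostBound

end RAM

/-! ### Single moves, ascents and local maxima -/

section Connectivity

open Relation

variable {n d : ℕ}

/-- Two elements of `R` that differ in at most one coordinate. -/
def SingleMove (R : Set (Fin n → Fin (d + 1))) (x y : Fin n → Fin (d + 1)) : Prop :=
  x ∈ R ∧ y ∈ R ∧ ∃ j v, y = Function.update x j v

/-- Reachability by single moves inside `R`. -/
def Conn (R : Set (Fin n → Fin (d + 1))) : (Fin n → Fin (d + 1)) → (Fin n → Fin (d + 1)) → Prop :=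
  ReflTransGen (SingleMove R)

/-- Reachability by single moves inside `R`, all of which increase the potential `φ`. -/
def Ascends (R : Set (Fin n → Fin (d + 1))) (φ : Fin n → Fin (d + 1) → ℤ) :
    (Fin n → Fin (d + 1)) → (Fin n → Fin (d + 1)) → Prop :=
  ReflTransGen fun x y =>
    x ∈ R ∧ y ∈ R ∧ ∃ j v, φ j (x j) < φ j v ∧ y = Function.update x j v

/-- No single move inside `R` increases the potential `φ`. -/
def IsLocMax (R : Set (Fin n → Fin (d + 1))) (φ : Fin n → Fin (d + 1) → ℤ)
    (x : Fin n → Fin (d + 1)) : Prop :=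
  ∀ j v, φ j (x j) < φ j v → Function.update x j v ∉ R

variable {R : Set (Fin n → Fin (d + 1))} {φ : Fin n → Fin (d + 1) → ℤ} {x y z : Fin n → Fin (d + 1)}

theorem SingleMove.symm (h : SingleMove R x y) : SingleMove R y x := by
  obtain ⟨hx, hy, j, v, rfl⟩ := h
  exact ⟨hy, hx, j, x j, by simp⟩

theorem Conn.symm (h : Conn R x y) : Conn R y x := by
  induction h with
  | refl => exact ReflTransGen.refl
  | tail _ h ih => exact ReflTransGen.head h.symm ih

theorem Conn.trans (h : Conn R x y) (h' : Conn R y z) : Conn R x z := ReflTransGen.trans h h'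

theorem Conn.mem (h : Conn R x y) (hx : x ∈ R) : y ∈ R := by
  induction h with
  | refl => exact hx
  | tail _ h _ => exact h.2.1

theorem Ascends.conn (h : Ascends R φ x y) : Conn R x y :=
  ReflTransGen.mono (fun _ _ ⟨hx, hy, j, v, _, h⟩ => ⟨hx, hy, j, v, h⟩) _ _ h

theorem Ascends.mem (h : Ascends R φ x y) (hx : x ∈ R) : y ∈ R := h.conn.mem hx

theorem Ascends.le (h : Ascends R φ x y) (j : Fin n) : φ j (x j) ≤ φ j (y j) := by
  induction h with
  | refl => exact le_rfl
  | tail _ h ih =>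
    obtain ⟨-, -, k, v, h1, rfl⟩ := h
    refine ih.trans ?_
    by_cases hjk : j = k
    · subst hjk; simpa using h1.le
    · simp [hjk]

/-- In particular a coordinate on which the potential is constant never moves. -/
theorem Ascends.eq_or_lt (h : Ascends R φ x y) (j : Fin n) :
    x j = y j ∨ φ j (x j) < φ j (y j) := by
  induction h with
  | refl => exact Or.inl rfl
  | tail h' h ih =>
    have h2 := Ascends.le h' j
    obtain ⟨-, -, k, v, h1, rfl⟩ := h
    by_cases hjk : j = k
    · subst hjk
      right
      simpa using h2.trans_lt h1
    · simpa [hjk] using ih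

theorem hammingDist_eq_one_iff {x y : Fin n → Fin (d + 1)} :
    hammingDist x y = 1 ↔ x ≠ y ∧ ∃ j v, y = Function.update x j v := by
  constructor
  · intro h
    refine ⟨fun e => by simp [e] at h, ?_⟩
    obtain ⟨j, hj⟩ := Finset.card_eq_one.1 h
    refine ⟨j, y j, funext fun k => ?_⟩
    by_cases hk : k = j
    · subst hk; simp
    · rw [Function.update_of_ne hk]
      by_contra hne
      have : k ∈ ({j} : Finset (Fin n)) := by
        rw [← hj]; simpa using fun e => hne e.symm
      simp [hk] at this
  · rintro ⟨hne, j, v, rfl⟩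
    refine le_antisymm ?_ (Nat.one_le_iff_ne_zero.2 (by simpa using hne))
    refine (Finset.card_le_card (t := {j}) fun k hk => ?_).trans (by simp)
    by_contra hkj
    simp only [Finset.mem_singleton] at hkj
    simp [hkj] at hk

/-- `SingleMove` also admits idle moves; they are discarded here. -/
theorem reachable_solutionGraph_iff (s t : R) :
    (solutionGraph R).Reachable s t ↔ Conn R s.1 t.1 := by
  rw [SimpleGraph.reachable_iff_reflTransGen]
  constructor
  · intro h
    induction h with
    | refl => exact ReflTransGen.refl
    | @tail b c _ h ih =>
      exact ih.tail ⟨b.2, c.2, (hammingDist_eq_one_iff.1 h).2⟩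
  · obtain ⟨s, hs⟩ := s
    obtain ⟨t, ht⟩ := t
    intro h
    dsimp only at h
    induction h with
    | refl => exact ReflTransGen.refl
    | @tail b c h1 h ih =>
      obtain ⟨hb, hc, h⟩ := h
      by_cases hbc : b = c
      · subst hbc; exact ih hb
      · exact (ih hb).tail (hammingDist_eq_one_iff.2 ⟨hbc, h⟩)

end Connectivity

/-! ### Implications between literals, and pushing along closed sets -/

namespace ILS

open Relation

/-- Literals: a coordinate with the direction up (`true`) or down (`false`). -/
abbrev Lit (I : ILS) := Fin I.n × Bool

/-- The sign of a direction. -/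
def sgn (b : Bool) : ℤ := if b then 1 else -1

@[simp] theorem sgn_true : sgn true = 1 := rfl
@[simp] theorem sgn_false : sgn false = -1 := rfl

variable {I : ILS}

/-- The literal with the opposite direction. -/
def Lit.neg (l : I.Lit) : I.Lit := (l.1, !l.2)

@[simp] theorem Lit.neg_neg (l : I.Lit) : l.neg.neg = l := by simp [Lit.neg]
@[simp] theorem Lit.neg_fst (l : I.Lit) : l.neg.1 = l.1 := rfl

/-- The coordinate occurs in row `i` with the sign of the literal. -/
def InRow (i : Fin I.m) (l : I.Lit) : Prop := 0 < (sgn l.2 : ℚ) * I.A i l.1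

/-- If the coordinate of `l` may move in its direction only, then so may that of `l'`. -/
def Edge (l l' : I.Lit) : Prop := ∃ i, l.1 ≠ l'.1 ∧ InRow i l.neg ∧ InRow i l'

theorem Edge.contra {l l' : I.Lit} (h : Edge l l') : Edge l'.neg l.neg := by
  obtain ⟨i, h1, h2, h3⟩ := h
  exact ⟨i, h1.symm, by simpa using h3, h2⟩

/-- Implications between literals. -/
def Implies : I.Lit → I.Lit → Prop := ReflTransGen Edge

theorem Implies.contra {l l' : I.Lit} (h : Implies l l') : Implies l'.neg l.neg := by
  induction h with
  | refl => exact ReflTransGen.refl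
  | tail _ h ih => exact ReflTransGen.head h.contra ih

/-- The literal does not imply its negation. -/
def Good (l : I.Lit) : Prop := ¬ Implies l l.neg

open Classical in
/-- The direction in which the set `C` of literals moves the coordinate `j`. -/
noncomputable def dir (C : Set I.Lit) (j : Fin I.n) : ℤ :=
  (if (j, true) ∈ C then 1 else 0) - if (j, false) ∈ C then 1 else 0

/-- `C` is closed under implications. -/
def EdgeClosed (C : Set I.Lit) : Prop := ∀ l ∈ C, ∀ l', Edge l l' → l' ∈ C

theorem EdgeClosed.implies {C : Set I.Lit} (hC : EdgeClosed C) {l l' : I.Lit} (hl : l ∈ C)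
    (h : Implies l l') : l' ∈ C := by
  induction h with
  | refl => exact hl
  | tail _ h ih => exact hC _ ih _ h

theorem dir_eq_sgn {C : Set I.Lit} {l : I.Lit} (h : l ∈ C) (h' : l.neg ∉ C) :
    dir C l.1 = sgn l.2 := by
  obtain ⟨j, b⟩ := l
  cases b <;> simp_all [dir, Lit.neg]

theorem exists_of_dir_ne_zero {C : Set I.Lit} {j : Fin I.n} (h : dir C j ≠ 0) :
    ∃ l : I.Lit, l.1 = j ∧ l ∈ C ∧ l.neg ∉ C := by
  by_cases h1 : (j, true) ∈ C
  · by_cases h2 : (j, false) ∈ C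
    · simp [dir, h1, h2] at h
    · exact ⟨(j, true), rfl, h1, h2⟩
  · by_cases h2 : (j, false) ∈ C
    · exact ⟨(j, false), rfl, h2, h1⟩
    · simp [dir, h1, h2] at h

theorem mem_solutions_iff {x : Fin I.n → Fin (I.d + 1)} :
    x ∈ I.solutions ↔ ∀ i, I.b i ≤ ∑ j, I.A i j * ((x j : ℕ) : ℚ) := Iff.rfl

/-- The comparison solution `p` may depend on the row; all feasibility arguments below choose it row
by row. -/
theorem mem_solutions_of_dominated {z : Fin I.n → Fin (I.d + 1)}
    (h : ∀ i, ∃ p ∈ I.solutions, ∀ j, I.A i j * ((p j : ℕ) : ℚ) ≤ I.A i j * ((z j : ℕ) : ℚ)) :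
    z ∈ I.solutions := by
  rw [mem_solutions_iff]
  intro i
  obtain ⟨p, hp, hpz⟩ := h i
  exact (mem_solutions_iff.1 hp i).trans (Finset.sum_le_sum fun j _ => hpz j)

theorem mul_le_mul_of_inRow {i : Fin I.m} {l : I.Lit} (h : InRow i l) {u v : ℕ}
    (huv : sgn l.2 * (u : ℤ) ≤ sgn l.2 * (v : ℤ)) : I.A i l.1 * (u : ℚ) ≤ I.A i l.1 * (v : ℚ) := by
  obtain ⟨j, b⟩ := l
  cases b
  · simp only [InRow, sgn_false] at h huv
    have h1 : (v : ℚ) ≤ u := by exact_mod_cast (by omega : v ≤ u)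
    push_cast at h
    nlinarith
  · simp only [InRow, sgn_true] at h huv
    have h1 : (u : ℚ) ≤ v := by exact_mod_cast (by omega : u ≤ v)
    push_cast at h
    nlinarith

theorem exists_inRow {i : Fin I.m} {j : Fin I.n} (h : I.A i j ≠ 0) :
    ∃ l : I.Lit, l.1 = j ∧ InRow i l := by
  rcases lt_or_gt_of_ne h with h | h
  · exact ⟨(j, false), rfl, by simpa [InRow] using h⟩
  · exact ⟨(j, true), rfl, by simpa [InRow] using h⟩

theorem eq_or_eq_neg {l l' : I.Lit} (h : l.1 = l'.1) : l' = l ∨ l' = l.neg := by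
  obtain ⟨j, b⟩ := l
  obtain ⟨j', b'⟩ := l'
  obtain rfl : j = j' := h
  cases b <;> cases b' <;> simp [Lit.neg]

/-- If the move lowers a row, closedness makes every other coordinate of that row one at which `x`
is at least as good as `w`, and at `j` the new vector equals `w`. -/
theorem update_mem_of_edgeClosed {C : Set I.Lit} (hC : EdgeClosed C)
    {x w : Fin I.n → Fin (I.d + 1)} (hx : x ∈ I.solutions) (hw : w ∈ I.solutions) (j : Fin I.n)
    (hj : dir C j * ((x j : ℕ) : ℤ) < dir C j * ((w j : ℕ) : ℤ))
    (hk : ∀ k, k ≠ j → dir C k * ((w k : ℕ) : ℤ) ≤ dir C k * ((x k : ℕ) : ℤ)) :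
    Function.update x j (w j) ∈ I.solutions := by
  refine mem_solutions_of_dominated fun i => ?_
  have h0 : dir C j ≠ 0 := by rintro h; simp [h] at hj
  obtain ⟨l, rfl, hl, hl'⟩ := exists_of_dir_ne_zero h0
  rw [dir_eq_sgn hl hl'] at hj
  -- Rows that the move lowers are compared with `w`, the others with `x`.
  by_cases hneg : InRow i l.neg
  · refine ⟨w, hw, fun k => ?_⟩
    by_cases hkj : k = l.1
    · subst hkj; simp
    rw [Function.update_of_ne hkj]
    by_cases hA : I.A i k = 0
    · simp [hA]
    obtain ⟨l', rfl, hrow⟩ := exists_inRow hA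
    have h1 : l' ∈ C := hC l hl l' ⟨i, fun h => hkj h.symm, hneg, hrow⟩
    -- The contrapositive edge from `l'.neg` would put `l.neg` into `C`.
    have h2 : l'.neg ∉ C := fun h => hl' (hC _ h _ ⟨i, hkj, by simpa using hrow, hneg⟩)
    have := hk _ hkj
    rw [dir_eq_sgn h1 h2] at this
    exact mul_le_mul_of_inRow hrow this
  · refine ⟨x, hx, fun k => ?_⟩
    by_cases hkj : k = l.1
    · subst hkj
      rw [Function.update_self]
      by_cases hA : I.A i l.1 = 0
      · simp [hA]
      obtain ⟨l', hll, hrow⟩ := exists_inRow hA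
      rcases eq_or_eq_neg hll.symm with rfl | rfl
      · exact mul_le_mul_of_inRow hrow hj.le
      · exact absurd hrow hneg
    · rw [Function.update_of_ne hkj]

/-- A local maximum of the potential given by a closed set of literals is a maximum on its
component. -/
theorem dir_mul_le_of_isLocMax {C : Set I.Lit} (hC : EdgeClosed C) {x w : Fin I.n → Fin (I.d + 1)}
    (hx : x ∈ I.solutions) (hmax : IsLocMax I.solutions (fun j v => dir C j * ((v : ℕ) : ℤ)) x)
    (hw : Conn I.solutions x w) (j : Fin I.n) :
    dir C j * ((w j : ℕ) : ℤ) ≤ dir C j * ((x j : ℕ) : ℤ) := by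
  induction hw generalizing j with
  | refl => exact le_rfl
  | @tail w w' _ h ih =>
    obtain ⟨hw, hw', k, v, rfl⟩ := h
    have hne : ∀ i, i ≠ k → dir C i * ((Function.update w k v i : ℕ) : ℤ) ≤
        dir C i * ((x i : ℕ) : ℤ) := fun i hi => by
      rw [Function.update_of_ne hi]; exact ih i
    by_cases hj : j = k
    · subst hj
      by_contra hlt
      rw [not_le] at hlt
      -- The first step that overtakes `x` is feasible at `x` itself.
      exact hmax j _ hlt (update_mem_of_edgeClosed hC hx hw' j hlt hne)
    · exact hne j hj

/-- Each of the two local maxima bounds the other. -/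
theorem eq_of_isLocMax {C : Set I.Lit} (hC : EdgeClosed C) {x y : Fin I.n → Fin (I.d + 1)}
    (hx : x ∈ I.solutions) (hxmax : IsLocMax I.solutions (fun j v => dir C j * ((v : ℕ) : ℤ)) x)
    (hymax : IsLocMax I.solutions (fun j v => dir C j * ((v : ℕ) : ℤ)) y)
    (h : Conn I.solutions x y) {j : Fin I.n} (hj : dir C j ≠ 0) : x j = y j := by
  have h1 := dir_mul_le_of_isLocMax hC hx hxmax h j
  have h2 := dir_mul_le_of_isLocMax hC (h.mem hx) hymax h.symm j
  have := mul_left_cancel₀ hj (le_antisymm h2 h1)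
  exact Fin.ext (by exact_mod_cast this)

/-- A row contains no three coordinates all of whose literals imply their negations. -/
def RowsBijunctive (I : ILS) : Prop :=
  ∀ (i : Fin I.m) (l : Fin 3 → I.Lit), Function.Injective (fun k => (l k).1) →
    (∀ k, InRow i (l k)) → ∃ k, Good (l k) ∨ Good (l k).neg

/-! ### Medians on the coordinates without a good literal -/

section Median

variable {x y : Fin I.n → Fin (I.d + 1)}

/-- In either direction only one of three values can be strictly better than their median. -/
theorem median_dominates {p : Fin 3 → ℤ} {v : ℤ} (hv : ∃ a b c : Fin 3, a ≠ b ∧ b ≠ c ∧ a ≠ c ∧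
      p a ≤ v ∧ v ≤ p b ∧ p c = v) (s : Bool) :
    ∃ a, ∀ b, b ≠ a → sgn s * p b ≤ sgn s * v := by
  obtain ⟨a, b, c, hab, hbc, hac, h1, h2, h3⟩ := hv
  cases s
  · refine ⟨a, fun e he => ?_⟩
    have : e = b ∨ e = c := by omega
    rcases this with rfl | rfl <;> simp only [sgn_false] <;> omega
  · refine ⟨b, fun e he => ?_⟩
    have : e = a ∨ e = c := by omega
    rcases this with rfl | rfl <;> simp only [sgn_true] <;> omega

/-- If `l'` implied its negation, then `l → l' → l'.neg → l.neg` by contraposition. -/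
theorem Good.of_implies {l l' : I.Lit} (hl : Good l) (h : Implies l l') : Good l' :=
  fun h' => hl ((h.trans h').trans h.contra)

/-- The new vector is the median of `x`, `w`, `y` on the coordinates without good literals: `v` at
`q`, and `x r` elsewhere by `hr`. A row through `q` has at most one further such coordinate; each of
the two rules out at most one of the three points, and a remaining point is dominated on the whole
row. -/
theorem median_mem (hI : RowsBijunctive I) {w : Fin I.n → Fin (I.d + 1)}
    (hagree : ∀ l : I.Lit, Good l → x l.1 = y l.1)
    (hmax : ∀ l : I.Lit, Good l → ¬ Good l.neg →
      sgn l.2 * ((w l.1 : ℕ) : ℤ) ≤ sgn l.2 * ((x l.1 : ℕ) : ℤ))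
    (hx : x ∈ I.solutions) (hy : y ∈ I.solutions) (hw : w ∈ I.solutions) {q : Fin I.n}
    (hq : ∀ b, ¬ Good ((q, b) : I.Lit)) {v : Fin (I.d + 1)}
    (hv : ∃ a b c : Fin 3, a ≠ b ∧ b ≠ c ∧ a ≠ c ∧
      ((![x, w, y] a q : ℕ) : ℤ) ≤ (v : ℕ) ∧ ((v : ℕ) : ℤ) ≤ (![x, w, y] b q : ℕ) ∧
      ((![x, w, y] c q : ℕ) : ℤ) = (v : ℕ))
    (hr : ∀ r, r ≠ q → (∀ b, ¬ Good ((r, b) : I.Lit)) → ∃ a b c : Fin 3, a ≠ b ∧ b ≠ c ∧ a ≠ c ∧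
      ((![x, w, y] a r : ℕ) : ℤ) ≤ (x r : ℕ) ∧ ((x r : ℕ) : ℤ) ≤ (![x, w, y] b r : ℕ) ∧
      ((![x, w, y] c r : ℕ) : ℤ) = (x r : ℕ)) :
    Function.update x q v ∈ I.solutions := by
  have hsol : ∀ a : Fin 3, ![x, w, y] a ∈ I.solutions := by
    intro a; fin_cases a <;> assumption
  refine mem_solutions_of_dominated fun i => ?_
  by_cases hAq : I.A i q = 0
  · refine ⟨x, hx, fun k => ?_⟩
    by_cases hk : k = q
    · subst hk; simp [hAq]
    · rw [Function.update_of_ne hk]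
  obtain ⟨lq, rfl, hlq⟩ := exists_inRow hAq
  have hbad : ∀ l : I.Lit, l.1 = lq.1 → ¬ Good l := by
    rintro ⟨j, b⟩ rfl; exact hq b
  -- the coordinates of the row other than the undirected ones
  have hother : ∀ k, k ≠ lq.1 → I.A i k ≠ 0 → (∃ b, Good ((k, b) : I.Lit)) → ∀ a : Fin 3,
      I.A i k * ((![x, w, y] a k : ℕ) : ℚ) ≤ I.A i k * ((x k : ℕ) : ℚ) := by
    rintro k hk hA ⟨b, hb⟩ a
    obtain ⟨l, rfl, hl⟩ := exists_inRow hA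
    -- There is an edge from `l.neg` to `lq`, which is not good. So `l` is good in its direction
    -- only, and `x` is extremal in it.
    have hnn : ¬ Good l.neg := fun h =>
      hbad lq rfl (h.of_implies (ReflTransGen.single ⟨i, hk, by simpa using hl, hlq⟩))
    have hg : Good l := by
      rcases eq_or_eq_neg (l := l) (l' := (l.1, b)) rfl with h | h
      · rwa [h] at hb
      · rw [h] at hb; exact absurd hb hnn
    fin_cases a
    · exact le_rfl
    · exact mul_le_mul_of_inRow hl (hmax l hg hnn)
    · simp [hagree l hg]
  obtain ⟨a, ha⟩ := median_dominates (p := fun a => ((![x, w, y] a lq.1 : ℕ) : ℤ)) hv lq.2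
  by_cases hsnd : ∃ l : I.Lit, l.1 ≠ lq.1 ∧ InRow i l ∧ ∀ b, ¬ Good ((l.1, b) : I.Lit)
  · obtain ⟨l, hl1, hl2, hl3⟩ := hsnd
    obtain ⟨a', ha'⟩ := median_dominates (p := fun a => ((![x, w, y] a l.1 : ℕ) : ℤ))
      (hr l.1 hl1 hl3) l.2
    obtain ⟨e, he, he'⟩ : ∃ e : Fin 3, e ≠ a ∧ e ≠ a' := by
      clear * -; revert a a'; decide
    refine ⟨_, hsol e, fun k => ?_⟩
    by_cases hk : k = lq.1
    · subst hk; rw [Function.update_self]; exact mul_le_mul_of_inRow hlq (ha e he)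
    rw [Function.update_of_ne hk]
    by_cases hA : I.A i k = 0
    · simp [hA]
    by_cases hk' : k = l.1
    · subst hk'; exact mul_le_mul_of_inRow hl2 (ha' e he')
    refine hother k hk hA ?_ e
    obtain ⟨l', rfl, hl'⟩ := exists_inRow hA
    -- The row already has two coordinates without good literals, so a third one must have a good
    -- literal.
    obtain ⟨c, hc⟩ := hI i ![lq, l, l'] (by
      intro c c' hcc
      fin_cases c <;> fin_cases c' <;> simp at hcc ⊢ <;>
        first | exact hl1 hcc | exact hl1 hcc.symm | exact hk hcc | exact hk hcc.symm
              | exact hk' hcc | exact hk' hcc.symm) (by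
      intro c; fin_cases c <;> assumption)
    fin_cases c
    · rcases hc with hc | hc
      · exact absurd hc (hbad _ rfl)
      · exact absurd hc (hbad _ rfl)
    · rcases hc with hc | hc
      · exact absurd hc (hl3 _)
      · exact absurd hc (hl3 _)
    · rcases hc with hc | hc
      · exact ⟨_, hc⟩
      · exact ⟨_, hc⟩
  · push Not at hsnd
    obtain ⟨e, he⟩ : ∃ e : Fin 3, e ≠ a := ⟨a + 1, by clear * -; revert a; decide⟩
    refine ⟨_, hsol e, fun k => ?_⟩
    by_cases hk : k = lq.1
    · subst hk; rw [Function.update_self]; exact mul_le_mul_of_inRow hlq (ha e he)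
    rw [Function.update_of_ne hk]
    by_cases hA : I.A i k = 0
    · simp [hA]
    obtain ⟨l', rfl, hl'⟩ := exists_inRow hA
    exact hother _ hk hA (hsnd l' hk hl') e

/-- No path from `x` ever gets strictly to the side of `y` at a coordinate without good literals
(`key`); applied to the end point `y` this forces equality there. -/
theorem eq_of_isLocMax_neg_sq (hI : RowsBijunctive I)
    (hagree : ∀ l : I.Lit, Good l → x l.1 = y l.1)
    (hmax : ∀ l : I.Lit, Good l → ¬ Good l.neg → ∀ w, Conn I.solutions x w →
      sgn l.2 * ((w l.1 : ℕ) : ℤ) ≤ sgn l.2 * ((x l.1 : ℕ) : ℤ))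
    (hx : x ∈ I.solutions)
    (hloc : IsLocMax I.solutions (fun j v => -(((y j : ℕ) : ℤ) - ((v : ℕ) : ℤ)) ^ 2) x)
    (hxy : Conn I.solutions x y) : x = y := by
  have hy := hxy.mem hx
  have key : ∀ w, Conn I.solutions x w → ∀ q, (∀ b, ¬ Good ((q, b) : I.Lit)) →
      (((w q : ℕ) : ℤ) - (x q : ℕ)) * (((y q : ℕ) : ℤ) - (x q : ℕ)) ≤ 0 := by
    intro w hw
    induction hw with
    | refl => simp
    | @tail w w' hxw h ih =>
      have hxw' : Conn I.solutions x w' := ReflTransGen.tail hxw h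
      obtain ⟨hw, hw', k, u, rfl⟩ := h
      have hne : ∀ r, r ≠ k → (∀ b, ¬ Good ((r, b) : I.Lit)) →
          (((Function.update w k u r : ℕ) : ℤ) - (x r : ℕ)) * (((y r : ℕ) : ℤ) - (x r : ℕ)) ≤ 0 :=
        fun r hr hg => by rw [Function.update_of_ne hr]; exact ih r hg
      intro q hq
      by_cases hqk : q = k
      swap
      · exact hne q hqk hq
      subst hqk
      by_contra hpos
      rw [not_le] at hpos
      rw [Function.update_self] at hpos
      -- At the other coordinates the path has not yet crossed, so `x r` lies between the path and
      -- `y r` and is the median.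
      have hr : ∀ r, r ≠ q → (∀ b, ¬ Good ((r, b) : I.Lit)) → ∃ a b c : Fin 3,
          a ≠ b ∧ b ≠ c ∧ a ≠ c ∧
          ((![x, Function.update w q u, y] a r : ℕ) : ℤ) ≤ (x r : ℕ) ∧
          ((x r : ℕ) : ℤ) ≤ (![x, Function.update w q u, y] b r : ℕ) ∧
          ((![x, Function.update w q u, y] c r : ℕ) : ℤ) = (x r : ℕ) := by
        intro r hrq hrg
        have h := hne r hrq hrg
        rcases mul_nonpos_iff.1 h with ⟨h1, h2⟩ | ⟨h1, h2⟩
        · exact ⟨2, 1, 0, by decide, by decide, by decide, by simp; omega,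
            sub_nonneg.1 h1, rfl⟩
        · exact ⟨1, 2, 0, by decide, by decide, by decide, sub_nonpos.1 h1,
            by simp; omega, rfl⟩
      have hcand : ∀ v : Fin (I.d + 1), (∃ a b c : Fin 3, a ≠ b ∧ b ≠ c ∧ a ≠ c ∧
          ((![x, Function.update w q u, y] a q : ℕ) : ℤ) ≤ (v : ℕ) ∧
          ((v : ℕ) : ℤ) ≤ (![x, Function.update w q u, y] b q : ℕ) ∧
          ((![x, Function.update w q u, y] c q : ℕ) : ℤ) = (v : ℕ)) →
          ¬ -(((y q : ℕ) : ℤ) - ((x q : ℕ) : ℤ)) ^ 2 < -(((y q : ℕ) : ℤ) - ((v : ℕ) : ℤ)) ^ 2 :=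
        fun v hv hlt => hloc q v hlt
          (median_mem hI hagree (fun l h1 h2 => hmax l h1 h2 _ hxw') hx hy hw' hq hv hr)
      -- The median at `q` is the one of `u` and `y q` nearer to `x q`; in both cases it is strictly
      -- closer to `y q` than `x q` is.
      rcases pos_and_pos_or_neg_and_neg_of_mul_pos hpos with ⟨h1, h2⟩ | ⟨h1, h2⟩
      · rcases le_total (u : ℕ) (y q : ℕ) with h | h
        · refine hcand u ⟨0, 2, 1, by decide, by decide, by decide, by simp; omega, by simpa using h,
            by simp⟩ ?_
          have : ((u : ℕ) : ℤ) ≤ (y q : ℕ) := by exact_mod_cast h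
          nlinarith
        · refine hcand (y q) ⟨0, 1, 2, by decide, by decide, by decide, by simp; omega,
            by simpa using h, by simp⟩ ?_
          nlinarith
      · rcases le_total (y q : ℕ) (u : ℕ) with h | h
        · refine hcand u ⟨2, 0, 1, by decide, by decide, by decide, by simpa using h, by simp; omega,
            by simp⟩ ?_
          have : ((y q : ℕ) : ℤ) ≤ (u : ℕ) := by exact_mod_cast h
          nlinarith
        · refine hcand (y q) ⟨1, 0, 2, by decide, by decide, by decide, by simpa using h,
            by simp; omega, by simp⟩ ?_
          nlinarith
  funext q
  by_cases hq : ∀ b, ¬ Good ((q, b) : I.Lit)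
  · have h := key y hxy q hq
    have h0 : ((y q : ℕ) : ℤ) - (x q : ℕ) = 0 := by nlinarith
    exact Fin.ext (by omega)
  · push Not at hq
    obtain ⟨b, hb⟩ := hq
    exact hagree _ hb

end Median

/-! ### What the linear program says about the implications -/

section LinearProgram

/-- The weight of a literal in the linear program. -/
def weight (α : Fin I.n → ℝ) (l : I.Lit) : ℝ := if l.2 then α l.1 else 1 - α l.1

theorem weight_neg (α : Fin I.n → ℝ) (l : I.Lit) : weight α l.neg = 1 - weight α l := by
  obtain ⟨j, b⟩ := l
  cases b <;> simp [weight, Lit.neg]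

/-- Working with `1 + ε` makes it unnecessary to know that the infimum is attained. -/
theorem exists_isLPFeasible (hI : I ∈ family 1) {ε : ℝ} (hε : 0 < ε) :
    ∃ α, I.IsLPFeasible (1 + ε) α := by
  have hne : {Z : ℝ | ∃ α : Fin I.n → ℝ, I.IsLPFeasible Z α}.Nonempty := by
    refine ⟨∑ i, ∑ j with I.A i j < 0, (1 : ℝ), fun _ => 0, fun i => ?_, fun j => by simp⟩
    simp only [Finset.sum_const_zero, sub_zero, zero_add]
    exact Finset.single_le_sum (f := fun i => ∑ j with I.A i j < 0, (1 : ℝ))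
      (fun i _ => Finset.sum_nonneg fun _ _ => zero_le_one) (Finset.mem_univ i)
  have hlt : sInf {Z : ℝ | ∃ α : Fin I.n → ℝ, I.IsLPFeasible Z α} < 1 + ε := by
    have : I.complexityIndex ≤ 1 := hI
    unfold complexityIndex at this
    linarith
  obtain ⟨Z, ⟨α, hα⟩, hZ⟩ := exists_lt_of_csInf_lt hne hlt
  exact ⟨α, fun i => (hα.1 i).trans hZ.le, hα.2⟩

/-- All terms of a row constraint are nonnegative, so any distinct coordinates of the row satisfy it
as well. -/
theorem sum_weight_le {Z : ℝ} {α : Fin I.n → ℝ} (h : I.IsLPFeasible Z α) {ι : Type*} [Fintype ι]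
    (i : Fin I.m) (l : ι → I.Lit) (hl : Function.Injective fun k => (l k).1)
    (hrow : ∀ k, InRow i (l k)) : ∑ k, weight α (l k) ≤ Z := by
  classical
  refine le_trans ?_ (h.1 i)
  rw [Finset.sum_filter, Finset.sum_filter, ← Finset.sum_add_distrib]
  set F : Fin I.n → ℝ := fun j => (if 0 < I.A i j then α j else 0) +
      if I.A i j < 0 then 1 - α j else 0 with hF
  have h1 : ∀ k, weight α (l k) = F (l k).1 := by
    intro k
    have := hrow k
    generalize l k = l' at this ⊢
    obtain ⟨j, b⟩ := l'
    cases b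
    · have h : I.A i j < 0 := by simpa [InRow] using this
      simp [hF, weight, h, h.le]
    · have h : 0 < I.A i j := by simpa [InRow] using this
      simp [hF, weight, h, h.le]
  rw [Finset.sum_congr rfl fun k _ => h1 k]
  refine (Finset.sum_image (f := F) (s := Finset.univ) (g := fun k => (l k).1)
    (fun _ _ _ _ h => hl h)).symm.le.trans ?_
  refine Finset.sum_le_sum_of_subset_of_nonneg (Finset.subset_univ _) fun j _ _ => ?_
  have := h.2 j
  simp only [hF]
  split_ifs <;> linarith

/-- An edge `l₁ → l₂` puts `l₁.neg` and `l₂` into one row, so the weight grows by at most `ε`. The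
length `p` of the path does not depend on `ε` and `α`, so `ε` can be chosen afterwards. -/
theorem Implies.weight_le {l l' : I.Lit} (h : Implies l l') :
    ∃ p : ℕ, ∀ ε : ℝ, ∀ α, I.IsLPFeasible (1 + ε) α → weight α l' ≤ weight α l + p * ε := by
  induction h with
  | refl => exact ⟨0, by simp⟩
  | @tail l₁ l₂ _ h ih =>
    obtain ⟨p, hp⟩ := ih
    refine ⟨p + 1, fun ε α hα => ?_⟩
    obtain ⟨i, h1, h2, h3⟩ := h
    have := sum_weight_le hα i ![l₁.neg, l₂] (by
      intro c c' hcc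
      fin_cases c <;> fin_cases c' <;> simp at hcc ⊢
      · exact h1 hcc
      · exact h1 hcc.symm) (by intro c; fin_cases c <;> assumption)
    simp only [Fin.sum_univ_two, Matrix.cons_val_zero, Matrix.cons_val_one, weight_neg] at this
    have := hp ε α hα
    push_cast
    linarith

theorem rowsBijunctive (hI : I ∈ family 1) : RowsBijunctive I := by
  intro i l hl hrow
  by_contra hcon
  push Not at hcon
  have h : ∀ k, ∃ p : ℕ, ∀ ε : ℝ, ∀ α, I.IsLPFeasible (1 + ε) α →
      weight α (l k).neg ≤ weight α (l k) + p * ε := fun k =>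
    Implies.weight_le (not_not.1 (hcon k).1)
  choose p hp using h
  -- Each weight is at least `(1 - p k * ε) / 2`. As three of them sum to at most `1 + ε`, one gets
  -- `1 ≤ (p 0 + p 1 + p 2 + 2) * ε`, whereas this `ε` makes the right side `1/4`.
  have hε : (0 : ℝ) < 1 / (4 * (p 0 + p 1 + p 2 + 2)) := by positivity
  obtain ⟨α, hα⟩ := exists_isLPFeasible hI hε
  set ε : ℝ := 1 / (4 * (p 0 + p 1 + p 2 + 2)) with hεdef
  have hmul : ε * (4 * (p 0 + p 1 + p 2 + 2)) = 1 := by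
    rw [hεdef]; field_simp
  have hs := sum_weight_le hα i l hl hrow
  rw [Fin.sum_univ_three] at hs
  have h0 := hp 0 ε α hα
  have h1 := hp 1 ε α hα
  have h2 := hp 2 ε α hα
  rw [weight_neg] at h0 h1 h2
  linarith

end LinearProgram

end ILS

/-! ### Memory layout and the feasibility test -/

namespace RAM

@[simp] theorem State.setReg_reg (σ : State) (x : ℕ) (z : ℤ) (y : ℕ) :
    (σ.setReg x z).reg y = if y = x then z else σ.reg y := by
  simp [setReg, Function.update_apply]

@[simp] theorem State.setReg_arr (σ : State) (x : ℕ) (z : ℤ) : (σ.setReg x z).arr = σ.arr := rfl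

@[simp] theorem State.setCell_reg (σ : State) (a : ℕ) (i z : ℤ) :
    (σ.setCell a i z).reg = σ.reg := rfl

theorem State.setCell_arr (σ : State) (a : ℕ) (i z : ℤ) (b : ℕ) (k : ℤ) :
    (σ.setCell a i z).arr b k = if b = a ∧ k = i then z else σ.arr b k := by
  by_cases h : b = a
  · subst h; simp [setCell, Function.update_apply]
  · simp [setCell, h]

theorem State.setCell_arr_of_ne (σ : State) {a b : ℕ} (i z : ℤ) (h : b ≠ a) :
    (σ.setCell a i z).arr b = σ.arr b := by
  simp [setCell, h]

/-- The matrix, the right hand side and the sizes are stored as in the input. -/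
structure HasInput (I : ILS) (σ : State) : Prop where
  n : σ.reg 0 = I.n
  m : σ.reg 1 = I.m
  d : σ.reg 2 = I.d
  num : ∀ (i : Fin I.m) (j : Fin I.n), σ.arr 0 ((i : ℕ) * I.n + (j : ℕ)) = (I.A i j).num
  den : ∀ (i : Fin I.m) (j : Fin I.n), σ.arr 1 ((i : ℕ) * I.n + (j : ℕ)) = (I.A i j).den
  bnum : ∀ i : Fin I.m, σ.arr 2 (i : ℕ) = (I.b i).num
  bden : ∀ i : Fin I.m, σ.arr 3 (i : ℕ) = (I.b i).den

/-- The program does not write the part of the memory that holds the system. -/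
def Prog.keepsInput (P : Prog) : Bool :=
  !(P.writesReg 0 || P.writesReg 1 || P.writesReg 2 || P.writesArr 0 || P.writesArr 1 ||
    P.writesArr 2 || P.writesArr 3)

theorem HasInput.frame {I : ILS} {P : Prog} {σ τ : State} (h : HasInput I σ) (hF : Frame P σ τ)
    (hP : P.keepsInput = true) : HasInput I τ := by
  simp only [Prog.keepsInput, Bool.not_eq_true', Bool.or_eq_false_iff] at hP
  obtain ⟨⟨⟨⟨⟨⟨h0, h1⟩, h2⟩, k0⟩, k1⟩, k2⟩, k3⟩ := hP
  constructor
  · rw [hF.reg 0 h0, h.n]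
  · rw [hF.reg 1 h1, h.m]
  · rw [hF.reg 2 h2, h.d]
  · rw [hF.arr 0 k0]; exact h.num
  · rw [hF.arr 1 k1]; exact h.den
  · rw [hF.arr 2 k2]; exact h.bnum
  · rw [hF.arr 3 k3]; exact h.bden

theorem HasInput.setReg {I : ILS} {σ : State} (h : HasInput I σ) {x : ℕ} (hx : 3 ≤ x) (z : ℤ) :
    HasInput I (σ.setReg x z) where
  n := by rw [State.setReg_reg, if_neg (by omega), h.n]
  m := by rw [State.setReg_reg, if_neg (by omega), h.m]
  d := by rw [State.setReg_reg, if_neg (by omega), h.d]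
  num := h.num
  den := h.den
  bnum := h.bnum
  bden := h.bden

theorem HasInput.setCell {I : ILS} {σ : State} (h : HasInput I σ) {a : ℕ} (ha : 4 ≤ a) (i z : ℤ) :
    HasInput I (σ.setCell a i z) where
  n := h.n
  m := h.m
  d := h.d
  num := by rw [State.setCell_arr_of_ne _ _ _ (by omega)]; exact h.num
  den := by rw [State.setCell_arr_of_ne _ _ _ (by omega)]; exact h.den
  bnum := by rw [State.setCell_arr_of_ne _ _ _ (by omega)]; exact h.bnum
  bden := by rw [State.setCell_arr_of_ne _ _ _ (by omega)]; exact h.bden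

/-- The array `a` holds the vector `x`. -/
def Holds {n d : ℕ} (a : ℕ) (x : Fin n → Fin (d + 1)) (σ : State) : Prop :=
  ∀ j : Fin n, σ.arr a ((j : ℕ) : ℤ) = ((x j : ℕ) : ℤ)

theorem Holds.setCell {n d a : ℕ} {x : Fin n → Fin (d + 1)} {σ : State} (h : Holds a x σ)
    (j : Fin n) (v : Fin (d + 1)) :
    Holds a (Function.update x j v) (σ.setCell a ((j : ℕ) : ℤ) ((v : ℕ) : ℤ)) := by
  intro k
  rw [State.setCell_arr]
  by_cases hk : k = j
  · subst hk; simp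
  · rw [if_neg, h k, Function.update_of_ne hk]
    rintro ⟨-, h⟩
    exact hk (Fin.ext (by exact_mod_cast h))

/-- When `A i j * x j` is added to a fraction, the sum of the absolute values of numerator and
denominator grows by at most this factor. -/
def growth (I : ILS) (i : Fin I.m) (j : Fin I.n) : ℕ := (I.A i j).num.natAbs * I.d + (I.A i j).den

/-- The bounds on the memory and on the number of iterations suffice for the system `I`. -/
structure CostBound.Fits (B : CostBound) (I : ILS) : Prop where
  m_le_N : I.m ≤ B.N
  m_le_V : I.m ≤ B.V
  n_le_N : 2 * I.n + 1 ≤ B.N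
  n_le_V : 2 * I.n + 1 ≤ B.V
  d_le_N : I.d + 1 ≤ B.N
  d_le_V : I.d + 1 ≤ B.V
  nd_le_N : I.n * I.d + 1 ≤ B.N
  nd_le_V : I.n * I.d + 1 ≤ B.V
  row_le_V : ∀ i, ∏ j, growth I i j ≤ B.V

open RAM.Expr

/-- Sets register `12` over register `13` to the value of row `11` at the vector in array `a`. -/
def rowValue (a : ℕ) : Prog :=
  .seq (.assign 12 (const 0)) <| .seq (.assign 13 (const 1)) <|
  forLoop 14 (reg 0) <|
  .seq (.assign 12 (add (mul (reg 12) (cell 1 (add (mul (reg 11) (reg 0)) (reg 14))))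
      (mul (mul (reg 13) (cell 0 (add (mul (reg 11) (reg 0)) (reg 14)))) (cell a (reg 14)))))
    (.assign 13 (mul (reg 13) (cell 1 (add (mul (reg 11) (reg 0)) (reg 14)))))

/-- Sets register `10` to `1` if the vector in array `a` is feasible, and to `0` otherwise. -/
def testFeasible (a : ℕ) : Prog :=
  .seq (.assign 10 (const 1)) <|
  forLoop 11 (reg 1) <| .seq (rowValue a) <|
  .ite (sub (mul (cell 2 (reg 11)) (reg 13)) (mul (reg 12) (cell 3 (reg 11))))
    (.assign 10 (const 0)) .skip

variable {B : CostBound} {I : ILS}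

theorem one_le_growth (i : Fin I.m) (j : Fin I.n) : 1 ≤ growth I i j := by
  have := (I.A i j).den_pos
  unfold growth
  omega

/-- All factors are at least one, so the bound for a full row covers its partial sums. -/
theorem prod_growth_le (hB : B.Fits I) (i : Fin I.m) {k : ℕ} (hk : k ≤ I.n) :
    ∏ j ∈ Finset.range k, (if h : j < I.n then growth I i ⟨j, h⟩ else 1) ≤ B.V := by
  refine le_trans ?_ (hB.row_le_V i)
  have : ∏ j, growth I i j =
      ∏ j ∈ Finset.range I.n, (if h : j < I.n then growth I i ⟨j, h⟩ else 1) := by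
    rw [Finset.prod_range]; simp
  rw [this]
  refine Finset.prod_le_prod_of_subset_of_one_le' (Finset.range_subset_range.2 hk) fun j _ _ => ?_
  split_ifs
  · exact one_le_growth _ _
  · exact le_rfl

theorem growth_step {P Q num den x : ℤ} {G d : ℕ} (hx : x.natAbs ≤ d)
    (h : P.natAbs + Q.natAbs ≤ G) :
    (P * den + Q * num * x).natAbs + (Q * den).natAbs ≤ G * (num.natAbs * d + den.natAbs) := by
  have h1 := Int.natAbs_add_le (P * den) (Q * num * x)
  simp only [Int.natAbs_mul] at h1 ⊢
  have h2 : Q.natAbs * num.natAbs * x.natAbs ≤ Q.natAbs * num.natAbs * d :=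
    Nat.mul_le_mul_left _ hx
  have h3 : (P.natAbs + Q.natAbs) * (num.natAbs * d + den.natAbs) ≤
      G * (num.natAbs * d + den.natAbs) := Nat.mul_le_mul_right _ h
  nlinarith [Nat.zero_le (P.natAbs * (num.natAbs * d))]

/-- The running fraction is never reduced; the third part of the invariant keeps numerator and
denominator within the memory bound. -/
theorem wp_rowValue (hB : B.Fits I) {a : ℕ} {σ : State} {x : Fin I.n → Fin (I.d + 1)}
    (hσ : σ.Bdd B.V) (hI : HasInput I σ) (hx : Holds a x σ) (i : Fin I.m)
    (hi : σ.reg 11 = (i : ℕ)) :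
    B.Wp (rowValue a) σ fun τ => 0 < τ.reg 13 ∧
      (τ.reg 12 : ℚ) = (∑ j, I.A i j * ((x j : ℕ) : ℚ)) * τ.reg 13 := by
  refine CostBound.wp_seq (CostBound.wp_assign hσ (by rfl) (by simp [Expr.eval]) fun hσ₁ => ?_)
  refine CostBound.wp_seq (CostBound.wp_assign hσ₁ (by rfl)
    (by have := B.two_le; simp [Expr.eval]; omega) fun hσ₂ => ?_)
  simp only [Expr.eval] at hσ₂ ⊢
  set σ' := (σ.setReg 12 0).setReg 13 1 with hσ'
  have hI' : HasInput I σ' := (hI.setReg (by omega) _).setReg (by omega) _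
  refine CostBound.Wp.mono (CostBound.wp_forLoop I.n (fun k τ => 0 < τ.reg 13 ∧
      (τ.reg 12 : ℚ) = (∑ j ∈ Finset.range k,
        if h : j < I.n then I.A i ⟨j, h⟩ * ((x ⟨j, h⟩ : ℕ) : ℚ) else 0) * τ.reg 13 ∧
      (τ.reg 12).natAbs + (τ.reg 13).natAbs ≤
        ∏ j ∈ Finset.range k, (if h : j < I.n then growth I i ⟨j, h⟩ else 1)) hσ₂ (by rfl) (by rfl)
      (by have := hB.n_le_N; omega) (by have := hB.n_le_V; omega) ?_ ?_ ?_) ?_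
  · simp [hσ']
  · intro τ hF
    have := hF.reg 0 rfl
    simp only [Expr.eval]
    rw [this, hI'.n]
  · intro k hk τ hτ hF hreg hJ
    have hIτ : HasInput I τ := hI'.frame hF rfl
    have h11 : τ.reg 11 = (i : ℕ) := by
      rw [hF.reg 11 rfl, hσ']; simpa using hi
    have hxk : τ.arr a k = (x ⟨k, hk⟩ : ℕ) := by
      rw [hF.arr a rfl]; exact hx ⟨k, hk⟩
    have hnum := hIτ.num i ⟨k, hk⟩
    have hden := hIτ.den i ⟨k, hk⟩
    simp only at hnum hden
    obtain ⟨hQ, hP, hG⟩ := hJ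
    have hdpos : (0 : ℤ) < (I.A i ⟨k, hk⟩).den := by exact_mod_cast (I.A i ⟨k, hk⟩).den_pos
    have hstep := growth_step (num := (I.A i ⟨k, hk⟩).num) (den := (I.A i ⟨k, hk⟩).den) (d := I.d)
      (x := ((x ⟨k, hk⟩ : ℕ) : ℤ)) (by simp; omega) hG
    have hprod := prod_growth_le hB i (k := k + 1) hk
    rw [Finset.prod_range_succ, dif_pos hk] at hprod
    simp only [growth, Int.natAbs_natCast] at hprod hstep
    have hV := hstep.trans hprod
    have e1 : (Expr.add (mul (reg 12) (cell 1 (add (mul (reg 11) (reg 0)) (reg 14))))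
      (mul (mul (reg 13) (cell 0 (add (mul (reg 11) (reg 0)) (reg 14)))) (cell a (reg 14)))).eval τ
      = τ.reg 12 * (I.A i ⟨k, hk⟩).den + τ.reg 13 * (I.A i ⟨k, hk⟩).num * (x ⟨k, hk⟩ : ℕ) := by
      simp only [Expr.eval, h11, hreg, hIτ.n, hnum, hden, hxk]
    refine CostBound.wp_seq (CostBound.wp_assign hτ (by rfl) (by rw [e1]; omega) fun hτ' => ?_)
    rw [e1] at hτ' ⊢
    have e2 : ∀ z, (mul (reg 13) (cell 1 (add (mul (reg 11) (reg 0)) (reg 14)))).eval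
        (τ.setReg 12 z) = τ.reg 13 * (I.A i ⟨k, hk⟩).den := by
      intro z
      simp [Expr.eval, h11, hreg, hIτ.n, hden]
    refine CostBound.wp_assign hτ' (by rfl) (by rw [e2]; omega) fun _ => ?_
    rw [e2]
    refine ⟨?_, ?_, ?_⟩
    · simp; positivity
    · simp only [State.setReg_reg]
      norm_num
      rw [Finset.sum_range_succ, dif_pos hk, hP]
      have hne : ((I.A i ⟨k, hk⟩).den : ℚ) ≠ 0 := by exact_mod_cast hdpos.ne'
      have : I.A i ⟨k, hk⟩ * ((I.A i ⟨k, hk⟩).den : ℚ) = (I.A i ⟨k, hk⟩).num :=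
        Rat.mul_den_eq_num _
      rw [← this]
      ring
    · simp only [State.setReg_reg]
      norm_num
      rw [Finset.prod_range_succ, dif_pos hk]
      simpa [growth] using hstep
  · rintro τ - - ⟨h1, h2, -⟩
    refine ⟨h1, ?_⟩
    rw [h2, Finset.sum_range]
    simp

open Classical in
theorem wp_testFeasible (hB : B.Fits I) {a : ℕ} {σ : State} {x : Fin I.n → Fin (I.d + 1)}
    (hσ : σ.Bdd B.V) (hI : HasInput I σ) (hx : Holds a x σ) :
    B.Wp (testFeasible a) σ fun τ => τ.reg 10 = if x ∈ I.solutions then 1 else 0 := by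
  refine CostBound.wp_seq (CostBound.wp_assign hσ (by rfl)
    (by have := B.two_le; simp [Expr.eval]; omega) fun hσ₁ => ?_)
  simp only [Expr.eval] at hσ₁ ⊢
  have hI' : HasInput I (σ.setReg 10 1) := hI.setReg (by omega) _
  refine CostBound.Wp.mono (CostBound.wp_forLoop I.m (fun k τ => τ.reg 10 =
      if ∀ i : Fin I.m, (i : ℕ) < k → I.b i ≤ ∑ j, I.A i j * ((x j : ℕ) : ℚ) then 1 else 0)
      hσ₁ (by rfl) (by rfl) hB.m_le_N hB.m_le_V ?_ ?_ ?_) ?_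
  · simp
  · intro τ hF
    have := hF.reg 1 rfl
    simp only [Expr.eval]
    rw [this, hI'.m]
  · intro k hk τ hτ hF hreg hJ
    have hIτ : HasInput I τ := hI'.frame hF rfl
    have hxτ : Holds a x τ := by
      intro j; rw [hF.arr a rfl]; exact hx j
    refine CostBound.wp_seq ((wp_rowValue hB hτ hIτ hxτ ⟨k, hk⟩ hreg).mono ?_)
    rintro ρ hρ hFρ ⟨hQ, hP⟩
    have h11 : ρ.reg 11 = k := by rw [hFρ.reg 11 rfl, hreg]
    have h10 : ρ.reg 10 = τ.reg 10 := hFρ.reg 10 rfl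
    have hIρ : HasInput I ρ := hIτ.frame hFρ rfl
    have hbn := hIρ.bnum ⟨k, hk⟩
    have hbd := hIρ.bden ⟨k, hk⟩
    simp only at hbn hbd
    have hdpos : (0 : ℚ) < (I.b ⟨k, hk⟩).den := by exact_mod_cast (I.b ⟨k, hk⟩).den_pos
    have hQ' : (0 : ℚ) < ρ.reg 13 := by exact_mod_cast hQ
    -- Comparison by cross multiplication, both denominators being positive.
    have hev : (0 < (Expr.sub (mul (cell 2 (reg 11)) (reg 13))
        (mul (reg 12) (cell 3 (reg 11)))).eval ρ) ↔
        ¬ I.b ⟨k, hk⟩ ≤ ∑ j, I.A ⟨k, hk⟩ j * ((x j : ℕ) : ℚ) := by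
      simp only [Expr.eval, h11, hbn, hbd, not_le, sub_pos]
      rw [← Int.cast_lt (R := ℚ)]
      push_cast
      rw [hP, ← Rat.mul_den_eq_num (I.b ⟨k, hk⟩)]
      generalize ∑ j, I.A ⟨k, hk⟩ j * ((x j : ℕ) : ℚ) = S
      have : I.b ⟨k, hk⟩ * ((I.b ⟨k, hk⟩).den : ℚ) * ρ.reg 13 - S * ρ.reg 13 * (I.b ⟨k, hk⟩).den =
        (I.b ⟨k, hk⟩ - S) * (((I.b ⟨k, hk⟩).den : ℚ) * ρ.reg 13) := by ring
      rw [← sub_pos, this, mul_pos_iff_of_pos_right (by positivity), sub_pos]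
    have hsplit : (∀ i : Fin I.m, (i : ℕ) < k + 1 → I.b i ≤ ∑ j, I.A i j * ((x j : ℕ) : ℚ)) ↔
        (∀ i : Fin I.m, (i : ℕ) < k → I.b i ≤ ∑ j, I.A i j * ((x j : ℕ) : ℚ)) ∧
        I.b ⟨k, hk⟩ ≤ ∑ j, I.A ⟨k, hk⟩ j * ((x j : ℕ) : ℚ) := by
      constructor
      · exact fun h => ⟨fun i hi => h i (by omega), h _ (by simp)⟩
      · rintro ⟨h1, h2⟩ i hi
        rcases Nat.lt_succ_iff_lt_or_eq.1 hi with h | h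
        · exact h1 i h
        · obtain rfl : i = ⟨k, hk⟩ := Fin.ext h
          exact h2
    refine CostBound.wp_ite hρ (by rfl) (fun h => ?_) (fun h => ?_)
    · rw [hev] at h
      refine CostBound.wp_assign hρ (by rfl) (by simp [Expr.eval]) fun _ => ?_
      rw [if_neg (fun h' => h (hsplit.1 h').2)]
      simp [Expr.eval]
    · rw [hev, not_not] at h
      refine CostBound.wp_skip hρ ?_
      simp only [hsplit, h, and_true]
      simpa [h10] using hJ
  · rintro τ - - h
    rw [h]
    simp [ILS.mem_solutions_iff]

end RAM

/-! ### Termination of ascents -/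

section Rank

variable {n d : ℕ} {R : Set (Fin n → Fin (d + 1))} {φ : Fin n → Fin (d + 1) → ℤ}
  {x y : Fin n → Fin (d + 1)}

/-- The number of values below the current ones with respect to the potential. -/
def potentialRank (φ : Fin n → Fin (d + 1) → ℤ) (x : Fin n → Fin (d + 1)) : ℕ :=
  ∑ j, (Finset.univ.filter fun v => φ j v < φ j (x j)).card

/-- A value is not below itself, so each coordinate contributes at most `d`. Unlike the potential
itself, the rank is bounded independently of the size of `φ`. -/
theorem potentialRank_le : potentialRank φ x ≤ n * d := by
  refine (Finset.sum_le_card_nsmul _ _ d fun j _ => ?_).trans (by simp)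
  have : (Finset.univ.filter fun v => φ j v < φ j (x j)) ⊆ Finset.univ.erase (x j) := by
    intro v hv
    simp only [Finset.mem_filter, Finset.mem_univ, true_and] at hv
    simp only [Finset.mem_erase, Finset.mem_univ, and_true]
    rintro rfl
    exact lt_irrefl _ hv
  simpa using Finset.card_le_card this

theorem Ascends.potentialRank_le (h : Ascends R φ x y) : potentialRank φ x ≤ potentialRank φ y :=
  Finset.sum_le_sum fun j _ => Finset.card_le_card fun v hv => by
    simp only [Finset.mem_filter, Finset.mem_univ, true_and] at hv ⊢
    exact hv.trans_le (h.le j)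

theorem potentialRank_lt_update {j : Fin n} {v : Fin (d + 1)} (h : φ j (x j) < φ j v) :
    potentialRank φ x < potentialRank φ (Function.update x j v) := by
  have hmono : ∀ k, φ k (x k) ≤ φ k (Function.update x j v k) := by
    intro k
    by_cases hk : k = j
    · subst hk; simpa using h.le
    · simp [hk]
  refine Finset.sum_lt_sum (fun k _ => Finset.card_le_card fun u hu => ?_)
    ⟨j, Finset.mem_univ _, Finset.card_lt_card ?_⟩
  · simp only [Finset.mem_filter, Finset.mem_univ, true_and] at hu ⊢
    exact hu.trans_le (hmono k)
  · rw [Finset.ssubset_iff_of_subset]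
    · exact ⟨x j, by simpa using h, by simp⟩
    · intro u hu
      simp only [Finset.mem_filter, Finset.mem_univ, true_and] at hu ⊢
      exact hu.trans_le (hmono j)

end Rank

/-! ### Greedy ascent to a local maximum -/

namespace RAM

open RAM.Expr

/-- If the test `c` succeeds, changes coordinate number `21` of the vector in array `a` to the
value in register `22`, unless the result is infeasible. -/
def tryMove (a : ℕ) (c : Expr) : Prog :=
  .ite c (.seq (.assign 23 (cell a (reg 21))) <| .seq (.store a (reg 21) (reg 22)) <|
    .seq (testFeasible a) <|
    .ite (sub (const 1) (reg 10)) (.store a (reg 21) (reg 23)) .skip) .skip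

/-- Makes feasible single moves that satisfy the test `c`, as long as there are any. -/
def ascend (a : ℕ) (c : Expr) : Prog :=
  forLoop 20 (add (mul (reg 0) (reg 2)) (const 1)) <| forLoop 21 (reg 0) <|
    forLoop 22 (add (reg 2) (const 1)) (tryMove a c)

variable {B : CostBound} {I : ILS} {φ : Fin I.n → Fin (I.d + 1) → ℤ}

/-- In array `a` there is a vector obtained from `y` by ascending; if it is still `y`, the moves in
`D` have been tried without success. -/
def Sweep (a : ℕ) (φ : Fin I.n → Fin (I.d + 1) → ℤ) (y : Fin I.n → Fin (I.d + 1))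
    (D : Fin I.n → Fin (I.d + 1) → Prop) (τ : State) : Prop :=
  ∃ x, Holds a x τ ∧ Ascends I.solutions φ y x ∧ (potentialRank φ y < potentialRank φ x ∨
    x = y ∧ ∀ j v, D j v → φ j (y j) < φ j v → Function.update y j v ∉ I.solutions)

theorem Sweep.mono {a : ℕ} {y : Fin I.n → Fin (I.d + 1)} {D D' : Fin I.n → Fin (I.d + 1) → Prop}
    {σ τ : State} (h : Sweep a φ y D σ) (harr : τ.arr a = σ.arr a) (hD : ∀ j v, D' j v → D j v) :
    Sweep a φ y D' τ := by
  obtain ⟨x, h1, h2, h3⟩ := h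
  refine ⟨x, fun j => by rw [harr]; exact h1 j, h2, h3.imp_right fun ⟨h4, h5⟩ => ⟨h4, ?_⟩⟩
  exact fun j v hjv => h5 j v (hD j v hjv)

/-- An accepted move raises the rank; a rejected one is restored and, if the vector is still `y`,
counts as tried. -/
theorem wp_tryMove (hB : B.Fits I) {a : ℕ} (ha : 4 ≤ a) {c : Expr} (hc : c.Simple = true)
    {σ : State} {y : Fin I.n → Fin (I.d + 1)} {D : Fin I.n → Fin (I.d + 1) → Prop}
    (hσ : σ.Bdd B.V) (hI : HasInput I σ) (hy : y ∈ I.solutions) (hS : Sweep a φ y D σ)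
    {j : Fin I.n} {v : Fin (I.d + 1)} (hj : σ.reg 21 = (j : ℕ)) (hv : σ.reg 22 = (v : ℕ))
    (hcond : ∀ x, Holds a x σ → (0 < c.eval σ ↔ φ j (x j) < φ j v)) :
    B.Wp (tryMove a c) σ (Sweep a φ y fun j' v' => D j' v' ∨ (j' = j ∧ v' = v)) := by
  obtain ⟨x, hx, hyx, hD⟩ := hS
  have hxR := hyx.mem hy
  refine CostBound.wp_ite hσ hc (fun h => ?_) (fun h => ?_)
  · rw [hcond x hx] at h
    refine CostBound.wp_seq (CostBound.wp_assign hσ (by rfl) (hσ.2 _ _) fun hσ₁ => ?_)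
    simp only [Expr.eval, hj, hx j] at hσ₁ ⊢
    refine CostBound.wp_seq (CostBound.wp_store hσ₁ (by rfl) (by rfl) (hσ₁.1 _) fun hσ₂ => ?_)
    simp only [Expr.eval, State.setReg_reg] at hσ₂ ⊢
    norm_num only [if_false] at hσ₂ ⊢
    rw [hj, hv] at hσ₂ ⊢
    have hx' : Holds a (Function.update x j v)
        ((σ.setReg 23 (x j : ℕ)).setCell a (j : ℕ) (v : ℕ)) :=
      Holds.setCell (σ := σ.setReg 23 (x j : ℕ)) hx j v
    refine CostBound.wp_seq ((wp_testFeasible hB hσ₂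
      ((hI.setReg (by omega) _).setCell ha _ _) hx').mono ?_)
    intro τ hτ hF h10
    have hxτ : Holds a (Function.update x j v) τ := by
      intro k; rw [hF.arr a rfl]; exact hx' k
    refine CostBound.wp_ite hτ (by rfl) (fun hlt => ?_) (fun hlt => ?_)
    · have hbad : Function.update x j v ∉ I.solutions := by
        intro hmem
        simp [Expr.eval, h10, hmem] at hlt
      refine CostBound.wp_store hτ (by rfl) (by rfl) (hτ.1 _) fun _ => ?_
      have h21 : τ.reg 21 = (j : ℕ) := by rw [hF.reg 21 rfl]; simpa using hj
      have h23 : τ.reg 23 = (x j : ℕ) := by rw [hF.reg 23 rfl]; simp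
      simp only [Expr.eval, h21, h23]
      refine ⟨x, ?_, hyx, hD.imp_right fun ⟨h4, h5⟩ => ⟨h4, ?_⟩⟩
      · simpa using hxτ.setCell j (x j)
      · subst h4
        rintro j' v' (hd | ⟨rfl, rfl⟩)
        · exact h5 j' v' hd
        · exact fun _ => hbad
    · have hgood : Function.update x j v ∈ I.solutions := by
        by_contra hmem
        simp [Expr.eval, h10, hmem] at hlt
      refine CostBound.wp_skip hτ ⟨_, hxτ, hyx.tail ⟨hxR, hgood, j, v, h, rfl⟩, Or.inl ?_⟩
      exact hyx.potentialRank_le.trans_lt (potentialRank_lt_update h)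
  · rw [hcond x hx] at h
    refine CostBound.wp_skip hσ ⟨x, hx, hyx, hD.imp_right fun ⟨h4, h5⟩ => ⟨h4, ?_⟩⟩
    subst h4
    rintro j' v' (hd | ⟨rfl, rfl⟩)
    · exact h5 j' v' hd
    · exact fun h' => absurd h' h

theorem keepsInput_ascend {a : ℕ} (ha : 4 ≤ a) (c : Expr) : (ascend a c).keepsInput = true := by
  have h : ∀ k < 4, (k == a) = false := fun k hk => by simp; omega
  simp [ascend, tryMove, testFeasible, rowValue, forLoop, Prog.keepsInput, Prog.writesReg,
    Prog.writesArr, h]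

/-- A sweep that changes the vector raises its rank, and one that does not has tried every move and
certifies a local maximum. Since the rank is at most `n * d`, `n * d + 1` sweeps suffice. -/
theorem wp_ascend (hB : B.Fits I) {a : ℕ} (ha : 4 ≤ a) {c : Expr} (hc : c.Simple = true)
    {σ : State} {x : Fin I.n → Fin (I.d + 1)}
    (hσ : σ.Bdd B.V) (hI : HasInput I σ) (hx : x ∈ I.solutions) (hxσ : Holds a x σ)
    (hcond : ∀ τ, Frame (ascend a c) σ τ → ∀ y, Holds a y τ → ∀ (j : Fin I.n) (v : Fin (I.d + 1)),
      τ.reg 21 = (j : ℕ) → τ.reg 22 = (v : ℕ) → (0 < c.eval τ ↔ φ j (y j) < φ j v)) :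
    B.Wp (ascend a c) σ fun τ => ∃ y, Holds a y τ ∧ Ascends I.solutions φ x y ∧
      IsLocMax I.solutions φ y := by
  have hkeep := keepsInput_ascend ha c
  have hreg02 : ∀ τ, Frame (ascend a c) σ τ → τ.reg 0 = I.n ∧ τ.reg 2 = I.d := fun τ hF =>
    ⟨(hI.frame hF hkeep).n, (hI.frame hF hkeep).d⟩
  refine CostBound.Wp.mono (CostBound.wp_forLoop (I.n * I.d + 1) (fun k τ => ∃ y, Holds a y τ ∧
    Ascends I.solutions φ x y ∧ (IsLocMax I.solutions φ y ∨ k ≤ potentialRank φ y)) hσ (by rfl)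
    (by rfl) hB.nd_le_N hB.nd_le_V ?_ ?_ ?_) ?_
  · exact ⟨x, hxσ, Relation.ReflTransGen.refl, Or.inr (Nat.zero_le _)⟩
  · intro τ hF
    obtain ⟨h0, h2⟩ := hreg02 τ hF
    simp [Expr.eval, h0, h2]
  · rintro k hk τ hτ hF - ⟨y, hyτ, hxy, hk'⟩
    have hy := hxy.mem hx
    refine CostBound.Wp.mono (CostBound.wp_forLoop I.n
      (fun j => Sweep a φ y fun j' _ => (j' : ℕ) < j) hτ (by rfl) (by rfl)
      (by have := hB.n_le_N; omega) (by have := hB.n_le_V; omega) ?_ ?_ ?_) ?_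
    · exact ⟨y, hyτ, Relation.ReflTransGen.refl, Or.inr ⟨rfl, by simp⟩⟩
    · intro τ' hF'
      have hF' := hF.trans (hF'.mono (Q := ascend a c) (by simp +contextual [ascend, forLoop,
        Prog.writesReg]) (by simp [ascend, forLoop, Prog.writesArr]))
      exact (hreg02 τ' hF').1
    · rintro j hj τ' hτ' hF' h21 hS
      have hF' := hF.trans (hF'.mono (Q := ascend a c) (by simp +contextual [ascend, forLoop,
        Prog.writesReg]) (by simp [ascend, forLoop, Prog.writesArr]))
      refine CostBound.Wp.mono (CostBound.wp_forLoop (I.d + 1)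
        (fun v => Sweep a φ y fun j' v' => (j' : ℕ) < j ∨ ((j' : ℕ) = j ∧ (v' : ℕ) < v)) hτ'
        (by rfl) (by rfl) hB.d_le_N hB.d_le_V ?_ ?_ ?_) ?_
      · exact hS.mono rfl (by simp)
      · intro τ'' hF''
        have hF'' := hF'.trans (hF''.mono (Q := ascend a c) (by simp +contextual [ascend, forLoop,
          Prog.writesReg]) (by simp [ascend, forLoop, Prog.writesArr]))
        simp [Expr.eval, (hreg02 τ'' hF'').2]
      · rintro v hv τ'' hτ'' hF'' h22 hS'
        have h21' : τ''.reg 21 = j := by rw [hF''.reg 21 rfl, h21]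
        have hF'' := hF'.trans (hF''.mono (Q := ascend a c) (by simp +contextual [ascend, forLoop,
          Prog.writesReg]) (by simp [ascend, forLoop, Prog.writesArr]))
        refine (wp_tryMove hB ha hc hτ'' (hI.frame hF'' hkeep) hy hS' (j := ⟨j, hj⟩)
          (v := ⟨v, hv⟩) h21' h22 fun z hz => hcond τ'' hF'' z hz _ _ h21' h22).mono ?_
        intro ρ _ _ hS''
        refine hS''.mono rfl fun j' v' h => ?_
        simp only [Fin.ext_iff]
        omega
      · intro ρ _ _ hS'
        refine hS'.mono rfl fun j' v' h => ?_
        have := v'.2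
        omega
    · rintro ρ - - ⟨z, hz, hyz, h⟩
      refine ⟨z, hz, hxy.trans hyz, ?_⟩
      rcases h with h | ⟨rfl, h⟩
      · right
        rcases hk' with hk' | hk'
        · exfalso
          -- A local maximum admits no first ascending move, so its rank cannot have grown.
          rcases Relation.ReflTransGen.cases_head hyz with rfl | ⟨w, ⟨-, hw, j, v, hjv, rfl⟩, -⟩
          · exact lt_irrefl _ h
          · exact hk' j v hjv hw
        · omega
      · exact Or.inl fun j v => h j v j.2
  · rintro τ - - ⟨y, h1, h2, h3⟩
    refine ⟨y, h1, h2, h3.resolve_right fun h => ?_⟩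
    have := potentialRank_le (φ := φ) (x := y)
    omega

end RAM

/-! ### Closing a set of literals under implications -/

namespace RAM

open RAM.Expr ILS

/-- The array that holds the marks of the literals with direction `b`. -/
def slot (b : Bool) : ℕ := if b then 6 else 7

/-- The product of the sign of `b` and an expression. -/
def signed (b : Bool) (e : Expr) : Expr := if b then e else sub (const 0) e

/-- If the literal of coordinate number `33` and direction `b` is marked, and row `32` has an edge
from it to the literal of coordinate number `34` and direction `b'`, marks the latter. -/
def markEdge (b b' : Bool) : Prog :=
  .ite (mul (cell (slot b) (reg 33)) (mul (sub (reg 33) (reg 34)) (sub (reg 33) (reg 34))))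
    (.ite (signed (!b) (cell 0 (add (mul (reg 32) (reg 0)) (reg 33))))
      (.ite (signed b' (cell 0 (add (mul (reg 32) (reg 0)) (reg 34))))
        (.store (slot b') (reg 34) (const 1)) .skip) .skip) .skip

/-- Marks all literals that are implied by the marked ones. -/
def closeMarks : Prog :=
  forLoop 31 (add (add (reg 0) (reg 0)) (const 1)) <| forLoop 32 (reg 1) <| forLoop 33 (reg 0) <|
  forLoop 34 (reg 0) <| .seq (markEdge true true) <| .seq (markEdge true false) <|
  .seq (markEdge false true) (markEdge false false)

/-- Removes all marks. -/
def clearMarks : Prog :=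
  forLoop 36 (reg 0) (.seq (.store 6 (reg 36) (const 0)) (.store 7 (reg 36) (const 0)))

variable {B : CostBound} {I : ILS}

/-- The marked literals are those of `C`. -/
def Marks (C : Finset I.Lit) (σ : State) : Prop :=
  ∀ (j : Fin I.n) (b : Bool), σ.arr (slot b) ((j : ℕ) : ℤ) = if (j, b) ∈ C then 1 else 0

theorem Marks.of_arr {C : Finset I.Lit} {σ τ : State} (h : Marks C σ)
    (h6 : τ.arr 6 = σ.arr 6) (h7 : τ.arr 7 = σ.arr 7) : Marks C τ := by
  intro j b
  rw [← h j b]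
  cases b
  · exact congrFun h7 _
  · exact congrFun h6 _

theorem Marks.setCell {C : Finset I.Lit} {σ : State} (h : Marks C σ) (l : I.Lit) :
    Marks (insert l C) (σ.setCell (slot l.2) ((l.1 : ℕ) : ℤ) 1) := by
  rintro j b
  have hslot : ∀ b b', slot b = slot b' ↔ b = b' := by decide
  rw [State.setCell_arr, h j b]
  have hcast : ((j : ℕ) : ℤ) = ((l.1 : ℕ) : ℤ) ↔ j = l.1 := by rw [Nat.cast_inj, Fin.ext_iff]
  by_cases hl : (j, b) = l
  · subst hl; simp
  · rw [if_neg]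
    · simp [hl]
    · rw [hcast, hslot]
      rintro ⟨h1, h2⟩
      exact hl (Prod.ext h2 h1)

theorem wp_clearMarks (hB : B.Fits I) {σ : State} (hσ : σ.Bdd B.V) (hI : HasInput I σ) :
    B.Wp clearMarks σ (Marks (∅ : Finset I.Lit)) := by
  refine CostBound.Wp.mono (CostBound.wp_forLoop I.n (fun k τ => ∀ (j : Fin I.n) b, (j : ℕ) < k →
    τ.arr (slot b) ((j : ℕ) : ℤ) = 0) hσ (by rfl) (by rfl) (by have := hB.n_le_N; omega)
    (by have := hB.n_le_V; omega) ?_ ?_ ?_) ?_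
  · simp
  · intro τ hF
    exact (hI.frame hF rfl).n
  · intro k hk τ hτ hF hreg hJ
    refine CostBound.wp_seq (CostBound.wp_store hτ (by rfl) (by rfl) (by simp [Expr.eval])
      fun hτ' => CostBound.wp_store hτ' (by rfl) (by rfl) (by simp [Expr.eval]) fun _ => ?_)
    intro j b hj
    simp only [Expr.eval, State.setCell_reg, State.setReg_arr, State.setCell_arr, hreg]
    rcases Nat.lt_succ_iff_lt_or_eq.1 hj with h | h
    · have := hJ j b h
      split_ifs <;> first | rfl | exact this
    · cases b <;> simp [slot, h]
  · intro τ _ _ h j b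
    simpa using h j b j.2

/-- The edge `l → l'` is due to row `i`. -/
def RowEdge (i : Fin I.m) (l l' : I.Lit) : Prop := l.1 ≠ l'.1 ∧ InRow i l.neg ∧ InRow i l'

/-- The marked literals are implied by `C₀`; if there are no new ones, then the edges in `D` have
been tried. -/
def MarkSweep (C₀ : Finset I.Lit) (D : Fin I.m → I.Lit → I.Lit → Prop) (τ : State) : Prop :=
  ∃ C, Marks C τ ∧ C₀ ⊆ C ∧ (∀ l ∈ C, ∃ l₀ ∈ C₀, Implies l₀ l) ∧ (C₀.card < C.card ∨
    C = C₀ ∧ ∀ i l l', D i l l' → RowEdge i l l' → l ∈ C₀ → l' ∈ C₀)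

theorem MarkSweep.mono {C₀ : Finset I.Lit} {D D' : Fin I.m → I.Lit → I.Lit → Prop} {σ τ : State}
    (h : MarkSweep C₀ D σ) (harr : τ.arr = σ.arr) (hD : ∀ i l l', D' i l l' → D i l l') :
    MarkSweep C₀ D' τ := by
  obtain ⟨C, h1, h2, h3, h4⟩ := h
  exact ⟨C, h1.of_arr (by rw [harr]) (by rw [harr]), h2, h3,
    h4.imp_right fun ⟨h5, h6⟩ => ⟨h5, fun i l l' h => h6 i l l' (hD _ _ _ h)⟩⟩

theorem eval_signed (b : Bool) (e : Expr) (σ : State) :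
    (signed b e).eval σ = sgn b * e.eval σ := by
  cases b <;> simp [signed, Expr.eval]

theorem inRow_iff {i : Fin I.m} {l : I.Lit} : InRow i l ↔ 0 < sgn l.2 * (I.A i l.1).num := by
  obtain ⟨j, b⟩ := l
  cases b <;> simp [InRow, Rat.num_pos, Rat.num_neg]

theorem wp_markEdge {C₀ : Finset I.Lit} {D : Fin I.m → I.Lit → I.Lit → Prop} {σ : State}
    (hσ : σ.Bdd B.V) (hI : HasInput I σ) (hS : MarkSweep C₀ D σ) {i : Fin I.m} {j j' : Fin I.n}
    (hi : σ.reg 32 = (i : ℕ)) (hj : σ.reg 33 = (j : ℕ)) (hj' : σ.reg 34 = (j' : ℕ)) (b b' : Bool) :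
    B.Wp (markEdge b b') σ
      (MarkSweep C₀ fun i₁ l l' => D i₁ l l' ∨ (i₁ = i ∧ l = (j, b) ∧ l' = (j', b'))) := by
  obtain ⟨C, h1, h2, h3, h4⟩ := hS
  -- The mark is 0 or 1, and the square tests whether the coordinates differ.
  have e1 : 0 < (mul (cell (slot b) (reg 33)) (mul (sub (reg 33) (reg 34))
      (sub (reg 33) (reg 34)))).eval σ ↔ (j, b) ∈ C ∧ j ≠ j' := by
    simp only [Expr.eval, hj, hj', h1 j b]
    have hz : (((j : ℕ) : ℤ) - ((j' : ℕ) : ℤ)) = 0 ↔ j = j' := by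
      rw [sub_eq_zero, Nat.cast_inj, Fin.ext_iff]
    by_cases hC : (j, b) ∈ C
    · simp only [hC, if_true, one_mul, true_and]
      rw [mul_self_pos, not_iff_not, hz]
    · simp [hC]
  have e2 : 0 < (signed (!b) (cell 0 (add (mul (reg 32) (reg 0)) (reg 33)))).eval σ ↔
      InRow i (Lit.neg ((j, b) : I.Lit)) := by
    rw [inRow_iff, eval_signed]
    simp only [Expr.eval, hi, hj, hI.n, hI.num]
    rfl
  have e3 : 0 < (signed b' (cell 0 (add (mul (reg 32) (reg 0)) (reg 34)))).eval σ ↔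
      InRow i ((j', b') : I.Lit) := by
    rw [inRow_iff, eval_signed]
    simp only [Expr.eval, hi, hj', hI.n, hI.num]
  have hskip : ¬ ((j, b) ∈ C ∧ RowEdge i ((j, b) : I.Lit) (j', b')) →
      MarkSweep C₀ (fun i₁ l l' => D i₁ l l' ∨ (i₁ = i ∧ l = (j, b) ∧ l' = (j', b'))) σ := by
    intro hn
    refine ⟨C, h1, h2, h3, h4.imp_right fun ⟨h5, h6⟩ => ⟨h5, ?_⟩⟩
    subst h5
    rintro i₁ l l' (h | ⟨rfl, rfl, rfl⟩) hE hl
    · exact h6 i₁ l l' h hE hl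
    · exact absurd ⟨hl, hE⟩ hn
  refine CostBound.wp_ite hσ (by cases b <;> rfl) (fun g1 => ?_) (fun g1 => CostBound.wp_skip hσ
    (hskip fun h => g1 (e1.2 ⟨h.1, h.2.1⟩)))
  refine CostBound.wp_ite hσ (by cases b <;> rfl) (fun g2 => ?_) (fun g2 => CostBound.wp_skip hσ
    (hskip fun h => g2 (e2.2 h.2.2.1)))
  refine CostBound.wp_ite hσ (by cases b' <;> rfl) (fun g3 => ?_) (fun g3 => CostBound.wp_skip hσ
    (hskip fun h => g3 (e3.2 h.2.2.2)))
  rw [e1] at g1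
  rw [e2] at g2
  rw [e3] at g3
  refine CostBound.wp_store hσ (by rfl) (by rfl)
    (by have := B.two_le; simp [Expr.eval]; omega) fun _ => ?_
  simp only [Expr.eval, hj']
  have himp : ∀ l ∈ insert ((j', b') : I.Lit) C, ∃ l₀ ∈ C₀, Implies l₀ l := by
    intro l hl
    rcases Finset.mem_insert.1 hl with rfl | hl
    · obtain ⟨l₀, hl₀, h⟩ := h3 _ g1.1
      exact ⟨l₀, hl₀, h.tail ⟨i, g1.2, g2, g3⟩⟩
    · exact h3 l hl
  refine ⟨insert (j', b') C, h1.setCell (j', b'), h2.trans (Finset.subset_insert _ _), himp, ?_⟩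
  by_cases hmem : (j', b') ∈ C
  · rw [Finset.insert_eq_of_mem hmem]
    refine h4.imp_right fun ⟨h5, h6⟩ => ⟨h5, ?_⟩
    subst h5
    rintro i₁ l l' (h | ⟨rfl, rfl, rfl⟩) hE hl
    · exact h6 i₁ l l' h hE hl
    · exact hmem
  · left
    rw [Finset.card_insert_of_notMem hmem]
    have := Finset.card_le_card h2
    omega

theorem wp_markEdges {C₀ : Finset I.Lit} {D : Fin I.m → I.Lit → I.Lit → Prop} {σ : State}
    (hσ : σ.Bdd B.V) (hI : HasInput I σ) (hS : MarkSweep C₀ D σ) {i : Fin I.m} {j j' : Fin I.n}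
    (hi : σ.reg 32 = (i : ℕ)) (hj : σ.reg 33 = (j : ℕ)) (hj' : σ.reg 34 = (j' : ℕ)) :
    B.Wp (.seq (markEdge true true) <| .seq (markEdge true false) <|
      .seq (markEdge false true) (markEdge false false)) σ
      (MarkSweep C₀ fun i₁ l l' => D i₁ l l' ∨ (i₁ = i ∧ l.1 = j ∧ l'.1 = j')) := by
  refine CostBound.wp_seq ((wp_markEdge hσ hI hS hi hj hj' true true).mono fun σ₁ k₁ F₁ S₁ => ?_)
  have i₁ : σ₁.reg 32 = (i : ℕ) := by rw [F₁.reg 32 rfl, hi]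
  have j₁ : σ₁.reg 33 = (j : ℕ) := by rw [F₁.reg 33 rfl, hj]
  have j₁' : σ₁.reg 34 = (j' : ℕ) := by rw [F₁.reg 34 rfl, hj']
  have I₁ := hI.frame F₁ rfl
  refine CostBound.wp_seq ((wp_markEdge k₁ I₁ S₁ i₁ j₁ j₁' true false).mono fun σ₂ k₂ F₂ S₂ => ?_)
  have i₂ : σ₂.reg 32 = (i : ℕ) := by rw [F₂.reg 32 rfl, i₁]
  have j₂ : σ₂.reg 33 = (j : ℕ) := by rw [F₂.reg 33 rfl, j₁]
  have j₂' : σ₂.reg 34 = (j' : ℕ) := by rw [F₂.reg 34 rfl, j₁']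
  have I₂ := I₁.frame F₂ rfl
  refine CostBound.wp_seq ((wp_markEdge k₂ I₂ S₂ i₂ j₂ j₂' false true).mono fun σ₃ k₃ F₃ S₃ => ?_)
  have i₃ : σ₃.reg 32 = (i : ℕ) := by rw [F₃.reg 32 rfl, i₂]
  have j₃ : σ₃.reg 33 = (j : ℕ) := by rw [F₃.reg 33 rfl, j₂]
  have j₃' : σ₃.reg 34 = (j' : ℕ) := by rw [F₃.reg 34 rfl, j₂']
  have I₃ := I₂.frame F₃ rfl
  refine (wp_markEdge k₃ I₃ S₃ i₃ j₃ j₃' false false).mono fun σ₄ _ _ S₄ => ?_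
  refine S₄.mono rfl ?_
  rintro i' ⟨k, b⟩ ⟨k', b'⟩ (h | ⟨rfl, rfl, rfl⟩)
  · exact Or.inl (Or.inl (Or.inl (Or.inl h)))
  · cases b <;> cases b' <;> simp

/-- A round adds a mark or finds the set closed. There are only `2 * n` literals, so `2 * n + 1`
rounds suffice. -/
theorem wp_closeMarks (hB : B.Fits I) {σ : State} {C₀ : Finset I.Lit} (hσ : σ.Bdd B.V)
    (hI : HasInput I σ) (hM : Marks C₀ σ) :
    B.Wp closeMarks σ fun τ => ∃ C : Finset I.Lit, Marks C τ ∧ C₀ ⊆ C ∧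
      (∀ l ∈ C, ∃ l₀ ∈ C₀, Implies l₀ l) ∧ EdgeClosed (C : Set I.Lit) := by
  have hsub : ∀ {P : Prog} {τ τ' : State}, Frame P τ τ' → Frame closeMarks σ τ →
      (∀ x, closeMarks.writesReg x = false → P.writesReg x = false) →
      (∀ x, closeMarks.writesArr x = false → P.writesArr x = false) → Frame closeMarks σ τ' :=
    fun h1 h2 h3 h4 => h2.trans (h1.mono h3 h4)
  have hIτ : ∀ {τ : State}, Frame closeMarks σ τ → HasInput I τ := fun h => hI.frame h rfl
  have hn : I.n ≤ B.N ∧ I.n ≤ B.V := by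
    have := hB.n_le_N
    have := hB.n_le_V
    omega
  refine CostBound.Wp.mono (CostBound.wp_forLoop (2 * I.n + 1) (fun k τ => ∃ C : Finset I.Lit,
    Marks C τ ∧ C₀ ⊆ C ∧ (∀ l ∈ C, ∃ l₀ ∈ C₀, Implies l₀ l) ∧
    (EdgeClosed (C : Set I.Lit) ∨ k ≤ C.card)) hσ (by rfl) (by rfl) hB.n_le_N hB.n_le_V
    ?_ ?_ ?_) ?_
  · exact ⟨C₀, hM, subset_rfl, fun l hl => ⟨l, hl, Relation.ReflTransGen.refl⟩,
      Or.inr (Nat.zero_le _)⟩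
  · intro τ hF
    have := (hIτ hF).n
    simp only [Expr.eval, this]
    push_cast
    ring
  · rintro k hk τ hτ hF - ⟨C, hC, hsubC, himp, hk'⟩
    refine CostBound.Wp.mono (CostBound.wp_forLoop I.m
      (fun i => MarkSweep C fun i' _ _ => (i' : ℕ) < i) hτ (by rfl) (by rfl) hB.m_le_N hB.m_le_V
      ?_ ?_ ?_) ?_
    · exact ⟨C, hC, subset_rfl, fun l hl => ⟨l, hl, Relation.ReflTransGen.refl⟩,
        Or.inr ⟨rfl, by simp⟩⟩
    · intro τ₁ hF₁
      exact (hIτ (hsub hF₁ hF (by simp +contextual [closeMarks, forLoop, Prog.writesReg])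
        (by simp [closeMarks, forLoop, Prog.writesArr]))).m
    · intro i hi τ₁ hτ₁ hF₁ h32 hS₁
      replace hF₁ := hsub hF₁ hF (by simp +contextual [closeMarks, forLoop, Prog.writesReg])
        (by simp [closeMarks, forLoop, Prog.writesArr])
      refine CostBound.Wp.mono (CostBound.wp_forLoop I.n
        (fun j => MarkSweep C fun i' l _ => (i' : ℕ) < i ∨ ((i' : ℕ) = i ∧ (l.1 : ℕ) < j)) hτ₁
        (by rfl) (by rfl) hn.1 hn.2 ?_ ?_ ?_) ?_
      · exact hS₁.mono rfl (by simp)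
      · intro τ₂ hF₂
        exact (hIτ (hsub hF₂ hF₁ (by simp +contextual [closeMarks, forLoop, Prog.writesReg])
          (by simp [closeMarks, forLoop, Prog.writesArr]))).n
      · intro j hj τ₂ hτ₂ hF₂ h33 hS₂
        have h32₂ : τ₂.reg 32 = i := by rw [hF₂.reg 32 rfl, h32]
        replace hF₂ := hsub hF₂ hF₁ (by simp +contextual [closeMarks, forLoop, Prog.writesReg])
          (by simp [closeMarks, forLoop, Prog.writesArr])
        refine CostBound.Wp.mono (CostBound.wp_forLoop I.n
          (fun j' => MarkSweep C fun i' l l' => (i' : ℕ) < i ∨ ((i' : ℕ) = i ∧ ((l.1 : ℕ) < j ∨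
            ((l.1 : ℕ) = j ∧ (l'.1 : ℕ) < j')))) hτ₂ (by rfl) (by rfl) hn.1 hn.2 ?_ ?_ ?_) ?_
        · exact hS₂.mono rfl (by simp)
        · intro τ₃ hF₃
          exact (hIτ (hsub hF₃ hF₂ (by simp +contextual [closeMarks, forLoop, Prog.writesReg])
            (by simp [closeMarks, forLoop, Prog.writesArr]))).n
        · intro j' hj' τ₃ hτ₃ hF₃ h34 hS₃
          have h32₃ : τ₃.reg 32 = i := by rw [hF₃.reg 32 rfl, h32₂]
          have h33₃ : τ₃.reg 33 = j := by rw [hF₃.reg 33 rfl, h33]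
          replace hF₃ := hsub hF₃ hF₂ (by simp +contextual [closeMarks, forLoop, Prog.writesReg])
            (by simp [closeMarks, forLoop, Prog.writesArr])
          refine (wp_markEdges hτ₃ (hIτ hF₃) hS₃ (i := ⟨i, hi⟩) (j := ⟨j, hj⟩) (j' := ⟨j', hj'⟩)
            h32₃ h33₃ h34).mono fun ρ _ _ hS => hS.mono rfl fun i' l l' h => ?_
          simp only [Fin.ext_iff]
          omega
        · intro ρ _ _ hS
          refine hS.mono rfl fun i' l l' h => ?_
          have := l'.1.2
          omega
      · intro ρ _ _ hS
        refine hS.mono rfl fun i' l l' h => ?_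
        have := l.1.2
        omega
    · rintro ρ - - ⟨C', h1, h2, h3, h4⟩
      refine ⟨C', h1, hsubC.trans h2, fun l hl => ?_, ?_⟩
      · obtain ⟨l₁, hl₁, h⟩ := h3 l hl
        obtain ⟨l₀, hl₀, h'⟩ := himp l₁ hl₁
        exact ⟨l₀, hl₀, h'.trans h⟩
      · rcases h4 with h4 | ⟨rfl, h4⟩
        · right
          rcases hk' with hk' | hk'
          · exfalso
            -- All marks are implied by literals of `C`, so a closed `C` cannot grow.
            refine h4.not_ge (Finset.card_le_card fun l hl => ?_)
            obtain ⟨l₀, hl₀, h⟩ := h3 l hl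
            exact hk'.implies hl₀ h
          · omega
        · left
          rintro l hl l' ⟨i, h⟩
          exact h4 i l l' i.2 h hl
  · rintro τ - - ⟨C, h1, h2, h3, h4⟩
    refine ⟨C, h1, h2, h3, h4.resolve_right fun h => ?_⟩
    have := Finset.card_le_univ C
    simp only [Fintype.card_prod, Fintype.card_fin, Fintype.card_bool] at this
    omega

end RAM

/-! ### The invariant of the pushes and the final criterion -/

namespace ILS

variable {I : ILS} {s t x y x' y' : Fin I.n → Fin (I.d + 1)}

/-- The state of the algorithm when the literals in `P` have been processed: `x` and `y` are
reachable from `s` and `t`; they agree where they have to, and `x` is extremal where only one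
direction is safe. -/
structure Pushed (s t : Fin I.n → Fin (I.d + 1)) (P : I.Lit → Prop)
    (x y : Fin I.n → Fin (I.d + 1)) : Prop where
  left : Conn I.solutions s x
  right : Conn I.solutions t y
  agree : Conn I.solutions s t → ∀ l, P l → Good l → x l.1 = y l.1
  max : ∀ l, P l → Good l → ¬ Good l.neg → ∀ w, Conn I.solutions x w →
    sgn l.2 * ((w l.1 : ℕ) : ℤ) ≤ sgn l.2 * ((x l.1 : ℕ) : ℤ)

/-- Where `C` has a direction, the new vectors agree as local maxima in one component; elsewhere
they have not moved. If `l₀` is good, its coordinate is of the first kind. -/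
theorem Pushed.step {P : I.Lit → Prop} (h : Pushed s t P x y) (hs : s ∈ I.solutions)
    {C : Set I.Lit} (hC : EdgeClosed C) {l₀ : I.Lit} (hl₀ : l₀ ∈ C) (hCl : ∀ l ∈ C, Implies l₀ l)
    (hx : Ascends I.solutions (fun j v => dir C j * ((v : ℕ) : ℤ)) x x')
    (hxmax : IsLocMax I.solutions (fun j v => dir C j * ((v : ℕ) : ℤ)) x')
    (hy : Ascends I.solutions (fun j v => dir C j * ((v : ℕ) : ℤ)) y y')
    (hymax : IsLocMax I.solutions (fun j v => dir C j * ((v : ℕ) : ℤ)) y') :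
    Pushed s t (fun l => P l ∨ l = l₀) x' y' := by
  have hsx := h.left.trans hx.conn
  have hty := h.right.trans hy.conn
  have hx' := hsx.mem hs
  have hdir : Good l₀ → dir C l₀.1 = sgn l₀.2 := fun hg =>
    dir_eq_sgn hl₀ fun hn => hg (hCl _ hn)
  refine ⟨hsx, hty, fun hst l hl hg => ?_, fun l hl hg hn w hw => ?_⟩
  · have hxy : Conn I.solutions x' y' := hsx.symm.trans (hst.trans hty)
    by_cases hd : dir C l.1 = 0
    · rcases hl with hl | rfl
      · have h1 := hx.eq_or_lt l.1
        have h2 := hy.eq_or_lt l.1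
        simp only [hd, zero_mul, lt_irrefl, or_false] at h1 h2
        rw [← h1, ← h2]
        exact h.agree hst l hl hg
      · rw [hdir hg] at hd
        cases hb : l.2 <;> simp [hb] at hd
    · exact eq_of_isLocMax hC hx' hxmax hymax hxy hd
  · rcases hl with hl | rfl
    · refine (h.max l hl hg hn w (hx.conn.trans hw)).trans ?_
      rcases hx.eq_or_lt l.1 with h1 | h1
      · rw [h1]
      · have hd : dir C l.1 ≠ 0 := fun hd => by simp [hd] at h1
        obtain ⟨l₁, h2, h3, h4⟩ := exists_of_dir_ne_zero hd
        rcases eq_or_eq_neg h2.symm with rfl | rfl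
        · rw [dir_eq_sgn h3 h4] at h1
          exact h1.le
        -- A push backwards needs `l.neg` in `C`. As `l.neg` is not good it implies `l`, so `C`
        -- would contain both and have no direction here.
        · have h5 : Implies l.neg l := by simpa [Good] using hn
          exact absurd (hC.implies h3 h5) (by simpa using h4)
    · rw [← hdir hg]
      exact dir_mul_le_of_isLocMax hC hx' hxmax hw l.1

theorem Pushed.conn_iff (hI : I ∈ family 1) (h : Pushed s t (fun _ => True) x y)
    (hs : s ∈ I.solutions)
    (hx : Ascends I.solutions (fun j v => -(((y j : ℕ) : ℤ) - ((v : ℕ) : ℤ)) ^ 2) x x')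
    (hxmax : IsLocMax I.solutions (fun j v => -(((y j : ℕ) : ℤ) - ((v : ℕ) : ℤ)) ^ 2) x') :
    Conn I.solutions s t ↔ x' = y := by
  have hsx := h.left.trans hx.conn
  constructor
  · intro hst
    have hagree : ∀ l : I.Lit, Good l → x' l.1 = y l.1 := by
      intro l hg
      -- The distance to `y` at this coordinate is already zero, and the ascent cannot increase it.
      have h1 := hx.le l.1
      simp only [h.agree hst l trivial hg, sub_self] at h1
      have h2 : ((y l.1 : ℕ) : ℤ) - ((x' l.1 : ℕ) : ℤ) = 0 := by nlinarith
      exact Fin.ext (by omega)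
    refine eq_of_isLocMax_neg_sq (rowsBijunctive hI) hagree (fun l hg hn w hw => ?_)
      (hsx.mem hs) hxmax (hsx.symm.trans (hst.trans h.right))
    rw [hagree l hg, ← h.agree hst l trivial hg]
    exact h.max l trivial hg hn w (hx.conn.trans hw)
  · rintro rfl
    exact hsx.trans h.right.symm

end ILS

/-! ### The program and its correctness -/

namespace RAM

open RAM.Expr ILS

/-- The test whether a move increases the potential given by the marks. -/
def markTest (a : ℕ) : Expr :=
  mul (sub (reg 22) (cell a (reg 21))) (sub (cell 6 (reg 21)) (cell 7 (reg 21)))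

/-- The test whether a move decreases the distance from the vector in array `5`. -/
def distTest : Expr :=
  sub (mul (sub (cell 5 (reg 21)) (cell 4 (reg 21))) (sub (cell 5 (reg 21)) (cell 4 (reg 21))))
    (mul (sub (cell 5 (reg 21)) (reg 22)) (sub (cell 5 (reg 21)) (reg 22)))

/-- Pushes both vectors in the directions implied by the literal of coordinate number `30` and
direction `b`. -/
def pushLiteral (b : Bool) : Prog :=
  .seq clearMarks <| .seq (.store (slot b) (reg 30) (const 1)) <| .seq closeMarks <|
  .seq (ascend 4 (markTest 4)) (ascend 5 (markTest 5))

/-- The program that decides the reconfiguration problem. -/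
def reconfiguration : Prog :=
  .seq (forLoop 30 (reg 0) (.seq (pushLiteral true) (pushLiteral false))) <|
  .seq (ascend 4 distTest) <|
  .seq (.assign 10 (const 1)) <|
  .seq (forLoop 35 (reg 0) <|
    .ite (mul (sub (cell 4 (reg 35)) (cell 5 (reg 35))) (sub (cell 4 (reg 35)) (cell 5 (reg 35))))
      (.assign 10 (const 0)) .skip) <|
  .assign 0 (reg 10)

variable {B : CostBound} {I : ILS}

/-- The difference of the two marks of a coordinate is `dir C`. -/
theorem wp_ascend_markTest (hB : B.Fits I) {a : ℕ} (ha : a = 4 ∨ a = 5) {σ : State}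
    {x : Fin I.n → Fin (I.d + 1)} {C : Finset I.Lit} (hσ : σ.Bdd B.V) (hI : HasInput I σ)
    (hx : x ∈ I.solutions) (hxσ : Holds a x σ) (hM : Marks C σ) :
    B.Wp (ascend a (markTest a)) σ fun τ => Marks C τ ∧ ∃ y, Holds a y τ ∧
      Ascends I.solutions (fun j v => dir (C : Set I.Lit) j * ((v : ℕ) : ℤ)) x y ∧
      IsLocMax I.solutions (fun j v => dir (C : Set I.Lit) j * ((v : ℕ) : ℤ)) y := by
  have hM' : ∀ {τ}, Frame (ascend a (markTest a)) σ τ → Marks C τ := by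
    intro τ hF
    rcases ha with rfl | rfl
    · exact hM.of_arr (hF.arr 6 rfl) (hF.arr 7 rfl)
    · exact hM.of_arr (hF.arr 6 rfl) (hF.arr 7 rfl)
  refine (wp_ascend hB (by omega) (by rfl) hσ hI hx hxσ ?_).mono
    fun τ _ hF h => ⟨hM' hF, h⟩
  intro τ hF y hy j v hj hv
  have h6 := hM' hF j true
  have h7 := hM' hF j false
  have hdir : dir (C : Set I.Lit) j = τ.arr 6 (j : ℕ) - τ.arr 7 (j : ℕ) := by
    simp only [slot] at h6 h7
    simp only [dir, Finset.mem_coe]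
    norm_num at h6 h7
    rw [h6, h7]
  simp only [markTest, Expr.eval, hj, hv, hy j, hdir]
  rw [← sub_pos (b := _ * ((y j : ℕ) : ℤ)), ← mul_sub, mul_comm]

theorem wp_pushLiteral (hB : B.Fits I) {σ : State} {s t x y : Fin I.n → Fin (I.d + 1)}
    {P : I.Lit → Prop} (hσ : σ.Bdd B.V) (hI : HasInput I σ) (hx : Holds 4 x σ) (hy : Holds 5 y σ)
    (hs : s ∈ I.solutions) (ht : t ∈ I.solutions) (hP : Pushed s t P x y) {j : Fin I.n}
    (hj : σ.reg 30 = (j : ℕ)) (b : Bool) :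
    B.Wp (pushLiteral b) σ fun τ => HasInput I τ ∧ τ.reg 30 = (j : ℕ) ∧ ∃ x' y', Holds 4 x' τ ∧
      Holds 5 y' τ ∧ Pushed s t (fun l => P l ∨ l = (j, b)) x' y' := by
  refine CostBound.wp_seq ((wp_clearMarks hB hσ hI).mono fun σ₁ k₁ F₁ M₁ => ?_)
  have I₁ := hI.frame F₁ rfl
  have j₁ : σ₁.reg 30 = (j : ℕ) := by rw [F₁.reg 30 rfl, hj]
  have x₁ : Holds 4 x σ₁ := by intro i; rw [F₁.arr 4 rfl]; exact hx i
  have y₁ : Holds 5 y σ₁ := by intro i; rw [F₁.arr 5 rfl]; exact hy i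
  refine CostBound.wp_seq (CostBound.wp_store k₁ (by rfl) (by rfl)
    (by have := B.two_le; simp [Expr.eval]; omega) fun k₂ => ?_)
  simp only [Expr.eval, j₁] at k₂ ⊢
  have M₂ : Marks (insert (j, b) ∅) (σ₁.setCell (slot b) ((j : ℕ) : ℤ) 1) := M₁.setCell (j, b)
  have hslot : 4 ≤ slot b ∧ 4 ≠ slot b ∧ 5 ≠ slot b := by cases b <;> decide
  have I₂ := I₁.setCell hslot.1 ((j : ℕ) : ℤ) 1
  have j₂ : (σ₁.setCell (slot b) ((j : ℕ) : ℤ) 1).reg 30 = (j : ℕ) := j₁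
  have x₂ : Holds 4 x (σ₁.setCell (slot b) ((j : ℕ) : ℤ) 1) := by
    intro i; rw [State.setCell_arr_of_ne _ _ _ hslot.2.1]; exact x₁ i
  have y₂ : Holds 5 y (σ₁.setCell (slot b) ((j : ℕ) : ℤ) 1) := by
    intro i; rw [State.setCell_arr_of_ne _ _ _ hslot.2.2]; exact y₁ i
  generalize σ₁.setCell (slot b) ((j : ℕ) : ℤ) 1 = σ₂ at *
  refine CostBound.wp_seq ((wp_closeMarks hB k₂ I₂ M₂).mono fun σ₃ k₃ F₃ h => ?_)
  obtain ⟨C, M₃, hsub, himp, hC⟩ := h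
  have I₃ := I₂.frame F₃ rfl
  have j₃ : σ₃.reg 30 = (j : ℕ) := by rw [F₃.reg 30 rfl, j₂]
  have x₃ : Holds 4 x σ₃ := by intro i; rw [F₃.arr 4 rfl]; exact x₂ i
  have y₃ : Holds 5 y σ₃ := by intro i; rw [F₃.arr 5 rfl]; exact y₂ i
  refine CostBound.wp_seq ((wp_ascend_markTest hB (Or.inl rfl) k₃ I₃ (hP.left.mem hs) x₃ M₃).mono
    fun σ₄ k₄ F₄ h => ?_)
  obtain ⟨M₄, x', x₄, hxx, hxmax⟩ := h
  have I₄ := I₃.frame F₄ rfl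
  have j₄ : σ₄.reg 30 = (j : ℕ) := by rw [F₄.reg 30 rfl, j₃]
  have y₄ : Holds 5 y σ₄ := by intro i; rw [F₄.arr 5 rfl]; exact y₃ i
  refine (wp_ascend_markTest hB (Or.inr rfl) k₄ I₄ (hP.right.mem ht) y₄ M₄).mono
    fun σ₅ k₅ F₅ h => ?_
  obtain ⟨M₅, y', y₅, hyy, hymax⟩ := h
  have x₅ : Holds 4 x' σ₅ := by intro i; rw [F₅.arr 4 rfl]; exact x₄ i
  refine ⟨I₄.frame F₅ rfl, by rw [F₅.reg 30 rfl, j₄], x', y', x₅, y₅,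
    hP.step hs hC (hsub (by simp)) (fun l hl => ?_) hxx hxmax hyy hymax⟩
  obtain ⟨l₀, hl₀, h⟩ := himp l hl
  simp only [insert_empty_eq, Finset.mem_singleton] at hl₀
  rwa [hl₀] at h

theorem wp_reconfiguration (hB : B.Fits I) (hfam : I ∈ family 1) {σ : State}
    {s t : Fin I.n → Fin (I.d + 1)} (hσ : σ.Bdd B.V) (hI : HasInput I σ) (hsσ : Holds 4 s σ)
    (htσ : Holds 5 t σ) (hs : s ∈ I.solutions) (ht : t ∈ I.solutions) :
    B.Wp reconfiguration σ fun τ => (Conn I.solutions s t → τ.reg 0 = 1) ∧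
      (¬ Conn I.solutions s t → τ.reg 0 = 0) := by
  have hn : I.n ≤ B.N ∧ I.n ≤ B.V := by
    have := hB.n_le_N
    have := hB.n_le_V
    omega
  have hloop := CostBound.wp_forLoop (B := B) (r := 30) (e := reg 0)
    (P := .seq (pushLiteral true) (pushLiteral false)) I.n
    (fun k τ => ∃ x y, Holds 4 x τ ∧ Holds 5 y τ ∧
    Pushed s t (fun l => (l.1 : ℕ) < k) x y) hσ (by rfl) (by rfl) hn.1 hn.2
    ⟨s, t, hsσ, htσ, Relation.ReflTransGen.refl, Relation.ReflTransGen.refl, by simp, by simp⟩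
    (fun τ hF => (hI.frame hF rfl).n) (by
      rintro k hk τ hτ hF hreg ⟨x, y, hx, hy, hP⟩
      refine CostBound.wp_seq ((wp_pushLiteral hB hτ (hI.frame hF rfl) hx hy hs ht hP
        (j := ⟨k, hk⟩) hreg true).mono ?_)
      rintro τ₁ hτ₁ - ⟨I₁, j₁, x₁, y₁, hx₁, hy₁, hP₁⟩
      refine (wp_pushLiteral hB hτ₁ I₁ hx₁ hy₁ hs ht hP₁ j₁ false).mono ?_
      rintro τ₂ - - ⟨-, -, x₂, y₂, hx₂, hy₂, hP₂⟩
      refine ⟨x₂, y₂, hx₂, hy₂, ?_⟩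
      convert hP₂ using 2 with l
      obtain ⟨i, b⟩ := l
      cases b <;> simp [Fin.ext_iff] <;> omega)
  refine CostBound.wp_seq (hloop.mono ?_)
  rintro σ₁ k₁ F₁ ⟨x, y, x₁, y₁, hP⟩
  have I₁ := hI.frame F₁ rfl
  replace hP : Pushed s t (fun _ => True) x y := by
    convert hP using 2 with l
    simp
  refine CostBound.wp_seq ((wp_ascend hB (a := 4) (c := distTest)
    (φ := fun j v => -(((y j : ℕ) : ℤ) - ((v : ℕ) : ℤ)) ^ 2) le_rfl (by rfl) k₁ I₁
    (hP.left.mem hs) x₁ ?_).mono ?_)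
  · intro τ hF z hz j v hj hv
    have hy : τ.arr 5 (j : ℕ) = (y j : ℕ) := by rw [hF.arr 5 rfl]; exact y₁ j
    simp only [distTest, Expr.eval, hj, hv, hz j, hy]
    rw [neg_lt_neg_iff, sub_pos, sq, sq]
  rintro σ₂ k₂ F₂ ⟨x', x₂, hxx, hxmax⟩
  have hiff := hP.conn_iff hfam hs hxx hxmax
  have I₂ := I₁.frame F₂ rfl
  have y₂ : Holds 5 y σ₂ := by intro i; rw [F₂.arr 5 rfl]; exact y₁ i
  refine CostBound.wp_seq (CostBound.wp_assign k₂ (by rfl)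
    (by have := B.two_le; simp [Expr.eval]; omega) fun k₃ => ?_)
  simp only [Expr.eval] at k₃ ⊢
  have hI₃ := I₂.setReg (x := 10) (by omega) 1
  refine CostBound.wp_seq (CostBound.Wp.mono (CostBound.wp_forLoop I.n (fun k τ => τ.reg 10 =
    if ∀ j : Fin I.n, (j : ℕ) < k → x' j = y j then 1 else 0) k₃ (by rfl) (by rfl) hn.1 hn.2
    (by simp) (fun τ hF => (hI₃.frame hF rfl).n) ?_) ?_)
  · intro k hk τ hτ hF hreg hJ
    have hx : τ.arr 4 k = (x' ⟨k, hk⟩ : ℕ) := by rw [hF.arr 4 rfl]; exact x₂ ⟨k, hk⟩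
    have hy : τ.arr 5 k = (y ⟨k, hk⟩ : ℕ) := by rw [hF.arr 5 rfl]; exact y₂ ⟨k, hk⟩
    have hsplit : (∀ i : Fin I.n, (i : ℕ) < k + 1 → x' i = y i) ↔
        (∀ i : Fin I.n, (i : ℕ) < k → x' i = y i) ∧ x' ⟨k, hk⟩ = y ⟨k, hk⟩ := by
      constructor
      · exact fun h => ⟨fun i hi => h i (by omega), h _ (by simp)⟩
      · rintro ⟨h1, h2⟩ i hi
        rcases Nat.lt_succ_iff_lt_or_eq.1 hi with h | h
        · exact h1 i h
        · obtain rfl : i = ⟨k, hk⟩ := Fin.ext h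
          exact h2
    have hev : 0 < (mul (sub (cell 4 (reg 35)) (cell 5 (reg 35)))
        (sub (cell 4 (reg 35)) (cell 5 (reg 35)))).eval τ ↔ ¬ x' ⟨k, hk⟩ = y ⟨k, hk⟩ := by
      simp only [Expr.eval, hreg, hx, hy]
      rw [mul_self_pos, not_iff_not, sub_eq_zero, Nat.cast_inj, Fin.ext_iff]
    refine CostBound.wp_ite hτ (by rfl) (fun h => ?_) (fun h => ?_)
    · rw [hev] at h
      refine CostBound.wp_assign hτ (by rfl) (by simp [Expr.eval]) fun _ => ?_
      rw [if_neg (fun h' => h (hsplit.1 h').2)]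
      simp [Expr.eval]
    · rw [hev, not_not] at h
      refine CostBound.wp_skip hτ ?_
      simp only [hsplit, h, and_true]
      simpa using hJ
  · intro τ hτ _ h10
    refine CostBound.wp_assign hτ (by rfl) (hτ.1 _) fun _ => ?_
    have hxy : (∀ j : Fin I.n, (j : ℕ) < I.n → x' j = y j) ↔ x' = y :=
      ⟨fun h => funext fun j => h j j.2, fun h j _ => by rw [h]⟩
    simp only [hxy] at h10
    rw [hiff]
    constructor
    · intro h; simp [Expr.eval, h10, h]
    · intro h; simp [Expr.eval, h10, h]

/-! ### Polynomial bounds on loops and memory -/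

theorem linear_add_mul_le_sq (n m d L : ℕ) :
    2 * n + m + d + L + n * d + 2 ≤ (n + m + d + L + 2) ^ 2 := by
  have : (n + m + d + L + 2) ^ 2 = 2 * n + m + d + L + n * d + 2 + (2 * n + 3 * m + 3 * d + 3 * L +
    2 + n ^ 2 + m ^ 2 + d ^ 2 + L ^ 2 + 2 * n * m + n * d + 2 * n * L + 2 * m * d + 2 * m * L +
    2 * d * L) := by ring
  omega

/-- The bound on the memory contents. -/
def memoryBound (I : ILS) : ℕ := 2 ^ (I.n + I.m + I.d + I.bitLength + 2) ^ 2

theorem natAbs_num_le (x : ℚ) : x.num.natAbs ≤ 2 ^ ratBits x :=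
  (Nat.lt_size_self _).le.trans
    (Nat.pow_le_pow_right (by omega) (by simp [ratBits, intBits]; omega))

theorem den_le (x : ℚ) : x.den ≤ 2 ^ ratBits x :=
  (Nat.lt_size_self _).le.trans
    (Nat.pow_le_pow_right (by omega) (by simp [ratBits, intBits]; omega))

/-- Multiplied over a row, this leaves an exponent of at most `I.bitLength + I.n * I.d`. -/
theorem growth_le (i : Fin I.m) (j : Fin I.n) : growth I i j ≤ 2 ^ (ratBits (I.A i j) + I.d) := by
  have h1 : (I.A i j).num.natAbs ≤ 2 ^ (I.A i j).num.natAbs.size := (Nat.lt_size_self _).le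
  have h2 : (I.A i j).den ≤ 2 ^ (I.A i j).den.size := (Nat.lt_size_self _).le
  have h3 : I.d + 1 ≤ 2 ^ I.d := Nat.lt_two_pow_self
  calc growth I i j ≤ 2 ^ (I.A i j).num.natAbs.size * 2 ^ (I.A i j).den.size * (I.d + 1) := by
        unfold growth
        have h4 : 1 ≤ 2 ^ (I.A i j).num.natAbs.size := Nat.one_le_two_pow
        have h5 : 1 ≤ 2 ^ (I.A i j).den.size := Nat.one_le_two_pow
        generalize 2 ^ (I.A i j).num.natAbs.size = a at *
        generalize 2 ^ (I.A i j).den.size = b at *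
        have h6 : (I.A i j).num.natAbs * I.d ≤ a * b * I.d :=
          Nat.mul_le_mul_right _ (h1.trans (Nat.le_mul_of_pos_right _ h5))
        have h7 : (I.A i j).den ≤ a * b := h2.trans (Nat.le_mul_of_pos_left _ h4)
        rw [mul_add]
        omega
    _ ≤ 2 ^ (I.A i j).num.natAbs.size * 2 ^ (I.A i j).den.size * 2 ^ I.d :=
        Nat.mul_le_mul_left _ h3
    _ ≤ 2 ^ (ratBits (I.A i j) + I.d) := by
        rw [← pow_add, ← pow_add]
        refine Nat.pow_le_pow_right (by omega) ?_
        simp only [ratBits, intBits, Int.natAbs_natCast]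
        omega

theorem sum_ratBits_le (i : Fin I.m) : ∑ j, ratBits (I.A i j) ≤ I.bitLength :=
  (Finset.single_le_sum (f := fun i => ∑ j, ratBits (I.A i j)) (fun _ _ => Nat.zero_le _)
    (Finset.mem_univ i)).trans (Nat.le_add_right _ _)

theorem ratBits_A_le (i : Fin I.m) (j : Fin I.n) : ratBits (I.A i j) ≤ I.bitLength :=
  (Finset.single_le_sum (f := fun j => ratBits (I.A i j)) (fun _ _ => Nat.zero_le _)
    (Finset.mem_univ j)).trans (sum_ratBits_le i)

theorem ratBits_b_le (i : Fin I.m) : ratBits (I.b i) ≤ I.bitLength :=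
  (Finset.single_le_sum (f := fun i => ratBits (I.b i)) (fun _ _ => Nat.zero_le _)
    (Finset.mem_univ i)).trans (Nat.le_add_left _ _)

theorem le_memoryBound {k e : ℕ} (hk : k ≤ 2 ^ e)
    (he : e ≤ (I.n + I.m + I.d + I.bitLength + 2) ^ 2) : k ≤ memoryBound I :=
  hk.trans (Nat.pow_le_pow_right (by omega) he)

theorem le_memoryBound' {k : ℕ} (hk : k ≤ (I.n + I.m + I.d + I.bitLength + 2) ^ 2) :
    k ≤ memoryBound I :=
  le_memoryBound Nat.lt_two_pow_self.le hk

theorem fits_of_le {B : CostBound} (hV : B.V = memoryBound I)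
    (hN : (I.n + I.m + I.d + 2) ^ 2 ≤ B.N) : B.Fits I where
  m_le_N := le_trans (by
    have := linear_add_mul_le_sq I.n I.m I.d 0
    simp only [add_zero] at this
    omega) hN
  m_le_V := hV ▸ le_memoryBound' (by
    have := linear_add_mul_le_sq I.n I.m I.d I.bitLength
    omega)
  n_le_N := le_trans (by
    have := linear_add_mul_le_sq I.n I.m I.d 0
    simp only [add_zero] at this
    omega) hN
  n_le_V := hV ▸ le_memoryBound' (by
    have := linear_add_mul_le_sq I.n I.m I.d I.bitLength
    omega)
  d_le_N := le_trans (by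
    have := linear_add_mul_le_sq I.n I.m I.d 0
    simp only [add_zero] at this
    omega) hN
  d_le_V := hV ▸ le_memoryBound' (by
    have := linear_add_mul_le_sq I.n I.m I.d I.bitLength
    omega)
  nd_le_N := le_trans (by
    have := linear_add_mul_le_sq I.n I.m I.d 0
    simp only [add_zero] at this
    omega) hN
  nd_le_V := hV ▸ le_memoryBound' (by
    have := linear_add_mul_le_sq I.n I.m I.d I.bitLength
    omega)
  row_le_V i := by
    rw [hV]
    refine le_memoryBound ((Finset.prod_le_prod' fun j _ => growth_le i j).trans
      (Finset.prod_pow_eq_pow_sum _ _ _).le) ?_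
    rw [Finset.sum_add_distrib]
    have := sum_ratBits_le i
    simp only [Finset.sum_const, Finset.card_univ, Fintype.card_fin, smul_eq_mul]
    have := linear_add_mul_le_sq I.n I.m I.d I.bitLength
    omega

theorem tabulate_coe {k : ℕ} (f : Fin k → ℤ) (i : Fin k) : tabulate f ((i : ℕ) : ℤ) = f i := by
  simp [tabulate]

theorem natAbs_tabulate_le {k V : ℕ} {f : Fin k → ℤ} (h : ∀ i, (f i).natAbs ≤ V) (i : ℤ) :
    (tabulate f i).natAbs ≤ V := by
  unfold tabulate
  split_ifs
  · exact h _
  · simp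

theorem tabulate_matrix {m n : ℕ} (f : Fin m → Fin n → ℤ) (i : Fin m) (j : Fin n) :
    tabulate (fun k : Fin (m * n) => f (finProdFinEquiv.symm k).1 (finProdFinEquiv.symm k).2)
      ((i : ℕ) * n + (j : ℕ)) = f i j := by
  have h : ((i : ℕ) : ℤ) * n + (j : ℕ) = ((finProdFinEquiv (i, j) : Fin (m * n)) : ℕ) := by
    simp [finProdFinEquiv]; ring
  rw [h, tabulate_coe, Equiv.symm_apply_apply]

theorem hasInput_input (s t : I.solutions) : HasInput I (input I s t) where
  n := rfl
  m := rfl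
  d := rfl
  num i j := tabulate_matrix (fun i j => (I.A i j).num) i j
  den i j := tabulate_matrix (fun i j => ((I.A i j).den : ℤ)) i j
  bnum i := tabulate_coe (fun i => (I.b i).num) i
  bden i := tabulate_coe (fun i => ((I.b i).den : ℤ)) i

theorem bdd_input (s t : I.solutions) : (input I s t).Bdd (memoryBound I) := by
  have hX := linear_add_mul_le_sq I.n I.m I.d I.bitLength
  have hE : I.bitLength ≤ (I.n + I.m + I.d + I.bitLength + 2) ^ 2 := by omega
  have hvec : ∀ v : Fin (I.d + 1), (((v : ℕ) : ℤ)).natAbs ≤ memoryBound I := fun v =>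
    le_memoryBound' (by have := v.2; simp only [Int.natAbs_natCast]; omega)
  constructor
  · intro x
    simp only [input]
    split_ifs <;> refine le_memoryBound' ?_ <;> simp only [Int.natAbs_natCast, Int.natAbs_zero] <;>
      omega
  · intro a i
    simp only [input]
    split_ifs
    · exact natAbs_tabulate_le (fun k => le_memoryBound (natAbs_num_le _)
        ((ratBits_A_le _ _).trans hE)) i
    · exact natAbs_tabulate_le (fun k => le_memoryBound (by simpa using den_le _)
        ((ratBits_A_le _ _).trans hE)) i
    · exact natAbs_tabulate_le (fun k => le_memoryBound (natAbs_num_le _)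
        ((ratBits_b_le _).trans hE)) i
    · exact natAbs_tabulate_le (fun k => le_memoryBound (by simpa using den_le _)
        ((ratBits_b_le _).trans hE)) i
    · exact natAbs_tabulate_le (fun k => hvec _) i
    · exact natAbs_tabulate_le (fun k => hvec _) i
    · simp

/-- Common to both cost models, which differ only in `B.w`, `B.N` and `B.K`. -/
theorem answers_reconfiguration (hfam : I ∈ family 1) (s t : I.solutions)
    (hV : B.V = memoryBound I) (hN : (I.n + I.m + I.d + 2) ^ 2 ≤ B.N) {T : ℕ}
    (hT : reconfiguration.steps B.N * (1 + 80 * B.K) ≤ T) :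
    Answers B.w reconfiguration (input I s t) (I.graph.Reachable s t) T := by
  obtain ⟨T', τ, h1, h2, -, h3⟩ := wp_reconfiguration (fits_of_le hV hN) hfam
    (hV ▸ bdd_input s t) (hasInput_input s t) (s := s.1) (t := t.1)
    (fun j => tabulate_coe (fun j => ((s.1 j : ℕ) : ℤ)) j)
    (fun j => tabulate_coe (fun j => ((t.1 j : ℕ) : ℤ)) j) s.2 t.2
  rw [← reachable_solutionGraph_iff] at h3
  exact ⟨T', τ, h1, h2.trans hT, h3⟩

theorem two_le_memoryBound (I : ILS) : 2 ≤ memoryBound I :=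
  le_memoryBound' (by
    have := linear_add_mul_le_sq I.n I.m I.d I.bitLength
    omega)

/-- With `E` the exponent of `memoryBound`, a value up to `2 ^ (40 * E)` has at most `40 * E + 1`
bits, plus the sign bit. -/
theorem logCost_le {z : ℤ} (h : z.natAbs ≤ memoryBound I ^ 40) :
    logCost z ≤ 2 + 40 * (I.n + I.m + I.d + I.bitLength + 2) ^ 2 := by
  have h1 : z.natAbs.size ≤ 40 * (I.n + I.m + I.d + I.bitLength + 2) ^ 2 + 1 := by
    rw [Nat.size_le]
    refine h.trans_lt ?_
    rw [memoryBound, ← pow_mul, mul_comm]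
    exact Nat.pow_lt_pow_right (by omega) (by omega)
  simp only [logCost, intBits]
  omega

end RAM

theorem mainTheorem3 :
    ∃ (P : RAM.Prog) (p q : Polynomial ℕ), ∀ I ∈ ILS.family 1, ∀ s t : I.solutions,
      RAM.Answers RAM.uniformCost P (RAM.input I s t) (I.graph.Reachable s t)
        (p.eval (I.n + I.m + I.d)) ∧
      RAM.Answers RAM.logCost P (RAM.input I s t) (I.graph.Reachable s t)
        (q.eval (I.n + I.m + I.d + I.bitLength)) := by
  obtain ⟨r, hr⟩ := RAM.reconfiguration.exists_polynomial_steps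
  -- `(X + 2) ^ 2` bounds the loop iterations. The price per command is `1 + 80 * K`, with `K = 1`
  -- for uniform cost and `K` from `logCost_le` for bit cost.
  refine ⟨RAM.reconfiguration, r.comp ((Polynomial.X + 2) ^ 2) * 81,
    r.comp ((Polynomial.X + 2) ^ 2) * (1 + 80 * (2 + 40 * (Polynomial.X + 2) ^ 2)),
    fun I hI s t => ⟨?_, ?_⟩⟩
  · exact RAM.answers_reconfiguration (B := ⟨RAM.uniformCost, RAM.memoryBound I,
      (I.n + I.m + I.d + 2) ^ 2, 1, RAM.two_le_memoryBound I, fun _ _ => le_rfl⟩) hI s t rfl le_rfl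
      (by simp [hr])
  · exact RAM.answers_reconfiguration (B := ⟨RAM.logCost, RAM.memoryBound I,
      (I.n + I.m + I.d + I.bitLength + 2) ^ 2, 2 + 40 * (I.n + I.m + I.d + I.bitLength + 2) ^ 2,
      RAM.two_le_memoryBound I, fun _ h => RAM.logCost_le h⟩) hI s t rfl
      (Nat.pow_le_pow_left (by omega) 2) (by simp [hr])
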